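/- **Setting.** Write $b(x)=x-x^{-1}$ and $[X,Y]_q=qXY-q^{-1}YX$. Let $q\in\mathbb C^*$ be not a root of unity, $2s\in\mathbb Z_{\ge 0}$, and $\mathsf b,\mathsf c,\mathsf b^*,\mathsf c^*,\zeta,\chi\in\mathbb C^*$ with $\mathsf b\mathsf c=\mathsf b^*\mathsf c^*$. Put $\theta_M=\mathsf bq^{2M}+\mathsf cq^{-2M}$, $\theta^*_N=\mathsf b^*q^{2N}+\mathsf c^*q^{-2N}$, and, with $e=\mathsf bq^{2s}+\mathsf cq^{-2s}$, $e^*=\mathsf b^*q^{2s}+\mathsf c^*q^{-2s}$, $z=\zeta^2+\zeta^{-2}$, $\kappa=q^{2s+1}+q^{-2s-1}$, $$\rho=-\mathsf b\mathsf c(q^2-q^{-2})^2,\qquad \omega=(q-q^{-1})^2(\mathsf b\mathsf c\,z\kappa-ee^*),$$ $$\eta=-\tfrac{(q^2-q^{-2})^2}{q+q^{-1}}\mathsf b\mathsf c\,(ez-e^*\kappa),\qquad \eta^*=-\tfrac{(q^2-q^{-2})^2}{q+q^{-1}}\mathsf b^*\mathsf c^*(e^*z-e\kappa).$$ The Askey–Wilson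 algebra is generated by $\mathsf A,\mathsf A^*$ with relations $$[\mathsf A,[\mathsf A,\mathsf A^*]_q]_{q^{-1}}=\rho\mathsf A^*+\omega\mathsf A+\eta,\qquad [\mathsf A^*,[\mathsf A^*,\mathsf A]_q]_{q^{-1}}=\rho\mathsf A+\omega\mathsf A^*+\eta^*.$$ Let $\pi$ be an irreducible representation of it on a complex vector space $\mathcal V$ of dimension $2s+1$, such that $\theta_0,\dots,\theta_{2s}$ are pairwise distinct, $\theta^*_0,\dots,\theta^*_{2s}$ are pairwise distinct, and there are nonzero covectors $\langle\theta_M|,\langle\theta^*_N|\in\mathcal V^\vee$ ($0\le M,N\le 2s$) with $\langle\theta_M|\pi(\mathsf A)=\theta_M\langle\theta_M|$ and $\langle\theta^*_N|\pi(\mathsf A^*)=\theta^*_N\langle\theta^*_N|$. Fix such covectors and let $\tilde A^*_{M,M'},\tilde A_{N,N'}$ be defined by $$\langle\theta_M|\pi(\mathsf A^*)=\sum_{M'}\tilde A^*_{M,M'}\langle\theta_{M'}|,\qquad \langle\theta^*_N|\pi(\mathsf A)=\sum_{N'}\tilde A_{N,N'}\langle\theta^*_{N'}|.$$ **Dynamical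 operators.** Let $\bar\eta(u)=(q+q^{-1})\rho^{-1}(\eta u+\eta^*u^{-1})$ and let $K(u)$ be the $2\times2$ matrix over the Askey–Wilson algebra with entries $$K_{11}=b(u^2)(qu\mathsf A-q^{-1}u^{-1}\mathsf A^*)-\bar\eta(u),\qquad K_{22}=b(u^2)(qu\mathsf A^*-q^{-1}u^{-1}\mathsf A)-\bar\eta(u^{-1}),$$ $$K_{12}=\chi\, b(u^2)\Big(\rho^{-1}\big([\mathsf A^*,\mathsf A]_q+\tfrac{\omega}{q-q^{-1}}\big)+\tfrac{qu^2+q^{-1}u^{-2}}{q^2-q^{-2}}\Big),$$ $$K_{21}=\rho\chi^{-1} b(u^2)\Big(\rho^{-1}\big([\mathsf A,\mathsf A^*]_q+\tfrac{\omega}{q-q^{-1}}\big)+\tfrac{qu^2+q^{-1}u^{-2}}{q^2-q^{-2}}\Big).$$ For $\epsilon=\pm1$ and $\alpha,\beta\in\mathbb C$ put $\gamma^\epsilon(u,m)=\alpha^{\frac{1-\epsilon}2}\beta^{\frac{1+\epsilon}2}q^{-m}u-\alpha^{\frac{1+\epsilon}2}\beta^{\frac{1-\epsilon}2}q^mu^{-1}$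 and $$\mathscr C^\epsilon(u,m)=-\frac{\epsilon\, q^{-\epsilon}u^{-\epsilon}}{\gamma^\epsilon(1,m-1)}\,\big(-1,\ \alpha q^{\epsilon m}u^{\epsilon}\big)\,K(u)\begin{pmatrix}\alpha q^{\epsilon m}u^{-\epsilon}\\ 1\end{pmatrix}.$$ Let $m_0\in\mathbb Z$. The dual Bethe states are $$\langle\Psi_-^M(\bar v,m_0)|=\langle\theta_0|\,\pi\big(\mathscr C^-(v_1,m_0+2)\cdots\mathscr C^-(v_M,m_0+2M)\big),\quad \alpha=0,\ (q^2-q^{-2})\chi^{-1}\beta\,\mathsf c\,q^{m_0-2}=-1,$$ $$\langle\Psi_+^N(\bar y,m_0)|=\langle\theta^*_0|\,\pi\big(\mathscr C^+(y_1,m_0+2)\cdots\mathscr C^+(y_N,m_0+2N)\big),\quad \alpha=0,\ (q^2-q^{-2})\chi^{-1}\beta\,\mathsf b^*q^{-m_0+2}=1.$$ **Homogeneous Bethe equations.** Let $$f(u,v)=\frac{b(qv/u)b(uv)}{b(v/u)b(quv)},\qquad h(u,v)=\frac{b(q^2uv)b(qu/v)}{b(quv)b(u/v)},$$ $$\Lambda_1^\epsilon(u)=\tfrac{q^{-2s-1}}{u^\epsilon}\big(q^{2s+1}u\zeta^{-1}-u^{-1}\zeta\big)\big(q^{2s+1}u\zeta-u^{-1}\zeta^{-1}\big)\big(u\mathsf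 c^*q^{-2s}+u^{-1}\mathsf bq^{2s}\big)\Big(u\big(\tfrac{\mathsf c}{\mathsf c^*}\big)^{\frac{1-\epsilon}2}+u^{-1}\big(\tfrac{\mathsf b^*}{\mathsf b}\big)^{\frac{1+\epsilon}2}\Big),$$ $$\Lambda_2^\epsilon(u)=\tfrac{b(u^2)q^{-2s-1}}{u^\epsilon b(qu^2)}\big(q^{2s-1}u^{-1}\zeta-u\zeta^{-1}\big)\big(q^{2s-1}u^{-1}\zeta^{-1}-u\zeta\big)\big(q^2u\mathsf bq^{2s}+u^{-1}\mathsf c^*q^{-2s}\big)\Big(q^2u\big(\tfrac{\mathsf b^*}{\mathsf b}\big)^{\frac{1+\epsilon}2}+u^{-1}\big(\tfrac{\mathsf c}{\mathsf c^*}\big)^{\frac{1-\epsilon}2}\Big).$$ A tuple $\bar u=(u_1,\dots,u_M)$ is called a *nontrivial admissible solution of sign $\epsilon$* if $u_i\ne0$, $u_i^2\neq u_i^{-2}$, $b(qu_i^2)\ne0$ for all $i$, the numbers $U_i=(qu_i^2+q^{-1}u_i^{-2})/(q+q^{-1})$ are pairwise distinct, and $$-\frac{b(u_i^2)}{b(qu_i^2)}\prod_{j\ne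 i}f(u_i,u_j)\,\Lambda_1^\epsilon(u_i)+\prod_{j\neq i}h(u_i,u_j)\,\Lambda_2^\epsilon(u_i)=0\qquad(i=1,\dots,M).$$ (Hypothesis 1 of the paper is that for each $0\le M,N\le2s$ such solutions $S_-^{M(h)}$ of sign $-$ with $M$ elements and $S_+^{*N(h)}$ of sign $+$ with $N$ elements exist.) **Lemma.** For every $0\le M\le2s$ and every nontrivial admissible solution $\bar v=(v_1,\dots,v_M)$ of sign $-$, $$\langle\theta_M|=\tilde{\mathcal N}_M(\bar v)\,\langle\Psi_-^M(\bar v,m_0)|,\qquad \tilde{\mathcal N}_M(\bar v)=\prod_{k=1}^M\big(q^{-1}v_k\,b(v_k^2)\,\tilde A^*_{k-1,k}\big)^{-1};$$ for every $0\le N\le2s$ and every nontrivial admissible solution $\bar y=(y_1,\dots,y_N)$ of sign $+$, $$\langle\theta^*_N|=\tilde{\mathcal N}^*_N(\bar y)\,\langle\Psi_+^N(\bar y,m_0)|,\qquad \tilde{\mathcal N}^*_N(\bar y)=\prod_{k=1}^N\big(-q\,y_k^{-1}\,b(y_k^2)\,\tilde A_{k-1,k}\big)^{-1}.$$ In particular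 $\tilde{\mathcal N}_0=\tilde{\mathcal N}^*_0=1$. -/

import Mathlib

noncomputable section

/-- The parameters: `q`, the eigenvalue parameters `b, c, bs = b*, cs = c*`, the structure
parameter `ζ`, the scalar `χ` of the `K`-matrix, and `d = 2s` (so `dim V = d + 1`). -/
structure AWParams where
  q : ℂ
  b : ℂ
  c : ℂ
  bs : ℂ
  cs : ℂ
  ζ : ℂ
  χ : ℂ
  d : ℕ

/-- `b(x) = x - x⁻¹`. -/
def bfun (x : ℂ) : ℂ := x - x⁻¹

/-- The `q`-commutator `[X, Y]_q = q X Y - q⁻¹ Y X`. -/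
def qcomm {R : Type*} [Ring R] [Algebra ℂ R] (q : ℂ) (X Y : R) : R :=
  q • (X * Y) - q⁻¹ • (Y * X)

namespace AWParams

/-- `θ_M = b q^{2M} + c q^{-2M}`. -/
def theta (P : AWParams) (M : ℕ) : ℂ := P.b * P.q ^ (2 * M) + P.c * (P.q ^ (2 * M))⁻¹

/-- `θ*_N = b* q^{2N} + c* q^{-2N}`. -/
def thetaStar (P : AWParams) (N : ℕ) : ℂ := P.bs * P.q ^ (2 * N) + P.cs * (P.q ^ (2 * N))⁻¹

/-- `ρ = - b c (q² - q⁻²)²`. -/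
def rho (P : AWParams) : ℂ := -(P.b * P.c * (P.q ^ 2 - (P.q ^ 2)⁻¹) ^ 2)

/-- `b q^{2s} + c q^{-2s}`. -/
def bc (P : AWParams) : ℂ := P.b * P.q ^ P.d + P.c * (P.q ^ P.d)⁻¹

/-- `b* q^{2s} + c* q^{-2s}`. -/
def bcStar (P : AWParams) : ℂ := P.bs * P.q ^ P.d + P.cs * (P.q ^ P.d)⁻¹

/-- `ζ² + ζ⁻²`. -/
def zz (P : AWParams) : ℂ := P.ζ ^ 2 + (P.ζ ^ 2)⁻¹

/-- `q^{2s+1} + q^{-2s-1}`. -/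
def qq (P : AWParams) : ℂ := P.q ^ (P.d + 1) + (P.q ^ (P.d + 1))⁻¹

/-- The structure constant `ω`. -/
def omega (P : AWParams) : ℂ :=
  (P.q - P.q⁻¹) ^ 2 * (P.b * P.c * P.zz * P.qq - P.bc * P.bcStar)

/-- The structure constant `η`. -/
def eta (P : AWParams) : ℂ :=
  -((P.q ^ 2 - (P.q ^ 2)⁻¹) ^ 2 / (P.q + P.q⁻¹) * (P.b * P.c) *
    (P.bc * P.zz - P.bcStar * P.qq))

/-- The structure constant `η*`. -/
def etaStar (P : AWParams) : ℂ :=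
  -((P.q ^ 2 - (P.q ^ 2)⁻¹) ^ 2 / (P.q + P.q⁻¹) * (P.bs * P.cs) *
    (P.bcStar * P.zz - P.bc * P.qq))

/-- The two defining relations of the Askey-Wilson algebra, imposed on the free algebra on
two generators (`0` for `A`, `1` for `A*`). -/
inductive AWRel (P : AWParams) : FreeAlgebra ℂ (Fin 2) → FreeAlgebra ℂ (Fin 2) → Prop
  | rel1 : AWRel P
      (qcomm P.q⁻¹ (FreeAlgebra.ι ℂ 0) (qcomm P.q (FreeAlgebra.ι ℂ 0) (FreeAlgebra.ι ℂ 1)))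
      (P.rho • FreeAlgebra.ι ℂ 1 + P.omega • FreeAlgebra.ι ℂ 0 + P.eta • 1)
  | rel2 : AWRel P
      (qcomm P.q⁻¹ (FreeAlgebra.ι ℂ 1) (qcomm P.q (FreeAlgebra.ι ℂ 1) (FreeAlgebra.ι ℂ 0)))
      (P.rho • FreeAlgebra.ι ℂ 0 + P.omega • FreeAlgebra.ι ℂ 1 + P.etaStar • 1)

/-- The Askey-Wilson algebra. -/
abbrev AW (P : AWParams) : Type := RingQuot (AWRel P)

/-- The generator `A`. -/
def genA (P : AWParams) : P.AW := RingQuot.mkAlgHom ℂ (AWRel P) (FreeAlgebra.ι ℂ 0)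

/-- The generator `A*`. -/
def genAStar (P : AWParams) : P.AW := RingQuot.mkAlgHom ℂ (AWRel P) (FreeAlgebra.ι ℂ 1)

/-- `η̄(u) = (q + q⁻¹) ρ⁻¹ (η u + η* u⁻¹)`. -/
def etaBar (P : AWParams) (u : ℂ) : ℂ :=
  (P.q + P.q⁻¹) * P.rho⁻¹ * (P.eta * u + P.etaStar * u⁻¹)

/-- The entries of the `K`-matrix `K(u)`, the solution of the reflection equation that gives the
reflection algebra presentation of the Askey-Wilson algebra. -/
def K (P : AWParams) (u : ℂ) : Matrix (Fin 2) (Fin 2) P.AW :=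
  let κ : ℂ := (P.q * u ^ 2 + (P.q * u ^ 2)⁻¹) / (P.q ^ 2 - (P.q ^ 2)⁻¹)
  let w : ℂ := P.omega / (P.q - P.q⁻¹)
  !![bfun (u ^ 2) • ((P.q * u) • P.genA - (P.q * u)⁻¹ • P.genAStar) - P.etaBar u • 1,
     (P.χ * bfun (u ^ 2)) •
       (P.rho⁻¹ • (qcomm P.q P.genAStar P.genA + w • 1) + κ • 1);
     (P.rho * P.χ⁻¹ * bfun (u ^ 2)) •
       (P.rho⁻¹ • (qcomm P.q P.genA P.genAStar + w • 1) + κ • 1),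
     bfun (u ^ 2) • ((P.q * u) • P.genAStar - (P.q * u)⁻¹ • P.genA) - P.etaBar u⁻¹ • 1]

/-- `γ^ε(u, m) = α^{(1-ε)/2} β^{(1+ε)/2} q^{-m} u - α^{(1+ε)/2} β^{(1-ε)/2} q^m u⁻¹`, for
`ε = ±1`. -/
def gam (P : AWParams) (α β : ℂ) (ε : ℤ) (u : ℂ) (m : ℤ) : ℂ :=
  α ^ ((1 - ε) / 2) * β ^ ((1 + ε) / 2) * P.q ^ (-m) * u -
    α ^ ((1 + ε) / 2) * β ^ ((1 - ε) / 2) * P.q ^ m * u⁻¹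

/-- The dynamical operator `𝒞^ε(u, m)` with gauge parameters `α, β`, for `ε = ±1`: with the
covariant vector `X^ε(u, m) = (α q^{εm} u^ε, 1)` and the row `(-1, α q^{εm} u^ε)`
orthogonal to it, `𝒞^ε(u, m)` is
`- ε q^{-ε} u^{-ε} γ^ε(1, m-1)⁻¹ (-1, α q^{εm} u^ε) K(u) X^ε(u⁻¹, m)`. -/
def dynC (P : AWParams) (α β : ℂ) (ε : ℤ) (u : ℂ) (m : ℤ) : P.AW :=
  (-(ε : ℂ) * P.q ^ (-ε) * u ^ (-ε) * (P.gam α β ε 1 (m - 1))⁻¹) •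
    (-((α * P.q ^ (ε * m) * u ^ (-ε)) • P.K u 0 0 + P.K u 0 1) +
      (α * P.q ^ (ε * m) * u ^ ε) •
        ((α * P.q ^ (ε * m) * u ^ (-ε)) • P.K u 1 0 + P.K u 1 1))

/-- The string `C^ε(v, m, N) = 𝒞^ε(v_1, m+2) 𝒞^ε(v_2, m+4) ⋯ 𝒞^ε(v_N, m+2N)`. -/
def stringC (P : AWParams) (α β : ℂ) (ε : ℤ) {N : ℕ} (v : Fin N → ℂ) (m : ℤ) : P.AW :=
  (List.ofFn fun i : Fin N => P.dynC α β ε (v i) (m + 2 * ((i : ℕ) + 1 : ℤ))).prod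

/-- The off-shell dual Bethe state `⟨Ω| π(C^ε(v, m₀, N))`, with `α = 0`. -/
def dualBethe (P : AWParams) {V : Type*} [AddCommGroup V] [Module ℂ V]
    (π : P.AW →ₐ[ℂ] Module.End ℂ V) (β : ℂ) (ε : ℤ) (Ω : Module.Dual ℂ V) {N : ℕ}
    (v : Fin N → ℂ) (m₀ : ℤ) : Module.Dual ℂ V :=
  Ω ∘ₗ π (P.stringC 0 β ε v m₀)

/-- `Λ_1^ε(u)`. -/
def Lam1 (P : AWParams) (ε : ℤ) (u : ℂ) : ℂ :=
  (P.q ^ (P.d + 1))⁻¹ / u ^ ε *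
    (P.q ^ (P.d + 1) * u * P.ζ⁻¹ - u⁻¹ * P.ζ) *
    (P.q ^ (P.d + 1) * u * P.ζ - u⁻¹ * P.ζ⁻¹) *
    (u * P.cs * (P.q ^ P.d)⁻¹ + u⁻¹ * P.b * P.q ^ P.d) *
    (u * (P.c / P.cs) ^ ((1 - ε) / 2) + u⁻¹ * (P.bs / P.b) ^ ((1 + ε) / 2))

/-- `Λ_2^ε(u)`. -/
def Lam2 (P : AWParams) (ε : ℤ) (u : ℂ) : ℂ :=
  (bfun (u ^ 2) * (P.q ^ (P.d + 1))⁻¹) / (u ^ ε * bfun (P.q * u ^ 2)) *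
    (P.q ^ ((P.d : ℤ) - 1) * u⁻¹ * P.ζ - u * P.ζ⁻¹) *
    (P.q ^ ((P.d : ℤ) - 1) * u⁻¹ * P.ζ⁻¹ - u * P.ζ) *
    (P.q ^ 2 * u * P.b * P.q ^ P.d + u⁻¹ * P.cs * (P.q ^ P.d)⁻¹) *
    (P.q ^ 2 * u * (P.bs / P.b) ^ ((1 + ε) / 2) + u⁻¹ * (P.c / P.cs) ^ ((1 - ε) / 2))

/-- `f(u, v) = b(qv/u) b(uv) / (b(v/u) b(quv))`. -/
def f (P : AWParams) (u v : ℂ) : ℂ :=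
  bfun (P.q * v / u) * bfun (u * v) / (bfun (v / u) * bfun (P.q * u * v))

/-- `h(u, v) = b(q²uv) b(qu/v) / (b(quv) b(u/v))`. -/
def h (P : AWParams) (u v : ℂ) : ℂ :=
  bfun (P.q ^ 2 * u * v) * bfun (P.q * u / v) / (bfun (P.q * u * v) * bfun (u / v))

/-- The function `E_ε^M(u_i, ū_i)` of the homogeneous Bethe equations. -/
def betheE (P : AWParams) (ε : ℤ) {M : ℕ} (u : Fin M → ℂ) (i : Fin M) : ℂ :=
  -(bfun (u i ^ 2) / bfun (P.q * u i ^ 2)) *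
      (∏ j ∈ Finset.univ.erase i, P.f (u i) (u j)) * P.Lam1 ε (u i) +
    (∏ j ∈ Finset.univ.erase i, P.h (u i) (u j)) * P.Lam2 ε (u i)

/-- The symmetrized Bethe root `U = (q u² + q⁻¹ u⁻²) / (q + q⁻¹)`. -/
def symRoot (P : AWParams) (u : ℂ) : ℂ :=
  (P.q * u ^ 2 + P.q⁻¹ * (u ^ 2)⁻¹) / (P.q + P.q⁻¹)

/-- Nontrivial admissible solutions of the homogeneous Bethe equations with sign `ε`. -/
structure IsBetheRoots (P : AWParams) (ε : ℤ) {M : ℕ} (u : Fin M → ℂ) : Prop where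
  ne_zero : ∀ i, u i ≠ 0
  nontrivial : ∀ i, u i ^ 2 ≠ (u i ^ 2)⁻¹
  /-- The denominators `b(q u_i²)` occurring in the equations do not vanish. -/
  wellDefined : ∀ i, bfun (P.q * u i ^ 2) ≠ 0
  admissible : ∀ i j, i ≠ j → P.symRoot (u i) ≠ P.symRoot (u j)
  bethe : ∀ i, P.betheE ε u i = 0

end AWParams

end

/-! With `α = 0` the row and column in `𝒞^ε(u, m)` select the entry `K₁₂(u)`, which is a scalar
times `S - U(u)`, where `S` is an affine function of `[A*, A]_q` and `U(u)` is the symmetrized root.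
A dual Bethe state is therefore a scalar times `∏ (S - U_j)` applied to the reference covector `Ω`,
and the claim concerns polynomials in `S`.

Eliminating `A*` from the two relations leaves a relation that is quadratic in `S` and linear in
`A`. Since `Ω` is an eigencovector and `A` maps `SΩ` to a combination of `SΩ` and `Ω`, this relation
makes `A` act on `ℂ[S]Ω` through an operator on polynomials, an Askey-Wilson operator
(`apply_aeval_eq_awOp`). It does not raise degrees, and it multiplies the leading coefficient in
degree `n` by `θ_n` (`awOp_coeff`). Its value at `U(u)` on `(X - U(u)) R` involves only `R(U(qu))`
and `R(U(u/q))` (`Generic.awOperator_eval`). The Bethe equations say exactly that the image of `Q =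
∏ (X - U_j)` vanishes at every `U_i`. The image minus `θ_M Q` then has degree below `M` and `M`
distinct zeros, so `Q` is an eigenvector (`awOp_prod_eq`).

The spectrum is simple, so `Q(S)Ω` is a multiple of `⟨θ_M|`. The factor is a product of first
superdiagonal entries of `S` (`IsAWPair.repr_aeval_prod`); these are multiples of `Ã*_{k-1,k}`,
nonzero by irreducibility. The sign `+` follows from the symmetry exchanging `A` and `A*` and
inverting `q` and the roots. -/

noncomputable section
open Polynomial

/-! ### Askey-Wilson operators on polynomials -/

/-- The images of the monomials under the Askey-Wilson operator with parameters `σ, τ`, inhomogeneity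
`g X + g'` and initial values `t₀`, `t₁ X + k`. -/
def awSeq (σ τ g g' t₀ t₁ k : ℂ) : ℕ → ℂ[X]
  | 0 => C t₀
  | 1 => C t₁ * X + C k
  | n + 2 => C σ * X * awSeq σ τ g g' t₀ t₁ k (n + 1) - X ^ 2 * awSeq σ τ g g' t₀ t₁ k n -
      C τ * (awSeq σ τ g g' t₀ t₁ k n + (C g * X + C g') * X ^ n)

/-- The Askey-Wilson operator on polynomials. -/
def awOp (σ τ g g' t₀ t₁ k : ℂ) : ℂ[X] →ₗ[ℂ] ℂ[X] :=
  (basisMonomials ℂ).constr ℂ (awSeq σ τ g g' t₀ t₁ k)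

section awOp
variable (σ τ g g' t₀ t₁ k : ℂ)

theorem awOp_X_pow (n : ℕ) : awOp σ τ g g' t₀ t₁ k (X ^ n) = awSeq σ τ g g' t₀ t₁ k n := by
  have := (basisMonomials ℂ).constr_basis ℂ (awSeq σ τ g g' t₀ t₁ k) n
  rw [coe_basisMonomials] at this
  exact (congrArg _ (monomial_one_right_eq_X_pow n).symm).trans this

theorem awOp_X_sq_mul (Q : ℂ[X]) :
    awOp σ τ g g' t₀ t₁ k (X ^ 2 * Q) =
      C σ * X * awOp σ τ g g' t₀ t₁ k (X * Q) - X ^ 2 * awOp σ τ g g' t₀ t₁ k Q -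
        C τ * (awOp σ τ g g' t₀ t₁ k Q + (C g * X + C g') * Q) := by
  induction Q using Polynomial.induction_on' with
  | add p r hp hr => simp only [mul_add, map_add, hp, hr]; ring
  | monomial n a =>
    have e1 : X ^ 2 * monomial n a = a • (X ^ (n + 2) : ℂ[X]) := by
      rw [← C_mul_X_pow_eq_monomial, smul_eq_C_mul]; ring
    have e2 : X * monomial n a = a • (X ^ (n + 1) : ℂ[X]) := by
      rw [← C_mul_X_pow_eq_monomial, smul_eq_C_mul]; ring
    have e3 : monomial n a = a • (X ^ n : ℂ[X]) := by
      rw [← C_mul_X_pow_eq_monomial, smul_eq_C_mul]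
    rw [e1, e2, e3]
    simp only [map_smul, awOp_X_pow, awSeq]
    simp only [smul_eq_C_mul]
    ring

/-- An operator satisfying the Askey-Wilson relation with `S` acts on `ℂ[S] Ω` as `awOp`. -/
theorem apply_aeval_eq_awOp {W : Type*} [AddCommGroup W] [Module ℂ W] (x S : Module.End ℂ W)
    (Ω : W) (h0 : x Ω = t₀ • Ω) (h1 : x (S Ω) = t₁ • S Ω + k • Ω)
    (hrel : x * S * S = σ • (S * x * S) - S * S * x - τ • (x + g • S + g' • 1)) (Q : ℂ[X]) :
    x (aeval S Q Ω) = aeval S (awOp σ τ g g' t₀ t₁ k Q) Ω := by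
  -- The relation moves `x` past two factors `S` at once, so the induction carries two consecutive
  -- powers.
  have key : ∀ n : ℕ, x (aeval S (X ^ n : ℂ[X]) Ω) = aeval S (awSeq σ τ g g' t₀ t₁ k n) Ω ∧
      x (aeval S (X ^ (n + 1) : ℂ[X]) Ω) = aeval S (awSeq σ τ g g' t₀ t₁ k (n + 1)) Ω := by
    intro n
    induction n with
    | zero => simp [awSeq, h0, h1, Module.algebraMap_end_apply]
    | succ n ih =>
      refine ⟨ih.2, ?_⟩
      obtain ⟨i1, i2⟩ := ih
      have e1 : (aeval S (X ^ (n + 1 + 1) : ℂ[X])) Ω = S (S (aeval S (X ^ n : ℂ[X]) Ω)) := by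
        have : (X ^ (n + 1 + 1) : ℂ[X]) = X * (X * X ^ n) := by ring
        rw [this]; simp only [map_mul, aeval_X, Module.End.mul_apply]
      have e2 : (aeval S (X ^ (n + 1) : ℂ[X])) Ω = S (aeval S (X ^ n : ℂ[X]) Ω) := by
        have : (X ^ (n + 1) : ℂ[X]) = X * X ^ n := by ring
        rw [this]; simp only [map_mul, aeval_X, Module.End.mul_apply]
      have := congrArg (fun f : Module.End ℂ W => f (aeval S (X ^ n : ℂ[X]) Ω)) hrel
      simp only [Module.End.mul_apply, LinearMap.sub_apply, LinearMap.smul_apply,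
        LinearMap.add_apply, Module.End.one_apply] at this
      rw [e1, this, ← e2, i2, i1]
      have e4 : awSeq σ τ g g' t₀ t₁ k (n + 1 + 1) =
          σ • (X * awSeq σ τ g g' t₀ t₁ k (n + 1)) - X * (X * awSeq σ τ g g' t₀ t₁ k n) -
          τ • (awSeq σ τ g g' t₀ t₁ k n + g • X ^ (n + 1) + g' • X ^ n) := by
        simp only [awSeq, smul_eq_C_mul]; ring
      rw [e4]
      simp only [map_sub, map_add, map_smul, map_mul, aeval_X, LinearMap.sub_apply,
        LinearMap.smul_apply, LinearMap.add_apply, Module.End.mul_apply]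
  induction Q using Polynomial.induction_on' with
  | add p r hp hr => simp only [map_add, LinearMap.add_apply, hp, hr]
  | monomial n a =>
    have e3 : monomial n a = a • (X ^ n : ℂ[X]) := by
      rw [← C_mul_X_pow_eq_monomial, smul_eq_C_mul]
    rw [e3]
    simp only [map_smul, LinearMap.smul_apply, awOp_X_pow, (key n).1]

variable {σ τ g g' t₀ t₁ k}

/-- The term with factor `τ` has degree at most `n + 1` in step `n + 2`, so it never reaches the top
coefficient, and the top coefficients obey the recursion of `t`. -/
theorem awSeq_coeff {t : ℕ → ℂ} (ht0 : t 0 = t₀) (ht1 : t 1 = t₁)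
    (ht : ∀ n, t (n + 2) = σ * t (n + 1) - t n) (n : ℕ) :
    (awSeq σ τ g g' t₀ t₁ k n).natDegree ≤ n ∧ (awSeq σ τ g g' t₀ t₁ k n).coeff n = t n := by
  have key : ∀ n : ℕ, ((awSeq σ τ g g' t₀ t₁ k n).natDegree ≤ n ∧
      (awSeq σ τ g g' t₀ t₁ k n).coeff n = t n) ∧
      ((awSeq σ τ g g' t₀ t₁ k (n + 1)).natDegree ≤ n + 1 ∧
      (awSeq σ τ g g' t₀ t₁ k (n + 1)).coeff (n + 1) = t (n + 1)) := by
    intro n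
    induction n with
    | zero =>
      refine ⟨by simp [awSeq, ht0], ?_, by simp [awSeq, ht1, coeff_C]⟩
      simp only [awSeq]; compute_degree
    | succ n ih =>
      refine ⟨ih.2, ?_⟩
      obtain ⟨⟨d1, c1⟩, d2, c2⟩ := ih
      have hd : (C τ * (awSeq σ τ g g' t₀ t₁ k n + (C g * X + C g') * X ^ n)).natDegree
          ≤ n + 1 := by
        refine natDegree_C_mul_le _ _ |>.trans (natDegree_add_le_of_degree_le (d1.trans (Nat.le_succ n)) ?_)
        compute_degree
        omega
      have e : awSeq σ τ g g' t₀ t₁ k (n + 1 + 1) =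
        C σ * (X * awSeq σ τ g g' t₀ t₁ k (n + 1)) - X * (X * awSeq σ τ g g' t₀ t₁ k n) -
          C τ * (awSeq σ τ g g' t₀ t₁ k n + (C g * X + C g') * X ^ n) := by
        simp only [awSeq]; ring
      have hX : ∀ (p : ℂ[X]) (m : ℕ), p.natDegree ≤ m → (X * p).natDegree ≤ m + 1 := by
        intro p m hp
        refine natDegree_mul_le.trans ?_
        rw [natDegree_X]; omega
      rw [e]
      constructor
      · refine (natDegree_sub_le _ _).trans (max_le ((natDegree_sub_le _ _).trans (max_le ?_ ?_))
          (hd.trans (Nat.le_succ (n + 1))))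
        · exact (natDegree_C_mul_le _ _).trans (hX _ _ d2)
        · exact hX _ _ (hX _ _ d1)
      · rw [coeff_sub, coeff_sub, coeff_C_mul, coeff_X_mul, coeff_X_mul, coeff_X_mul, c1, c2,
          coeff_eq_zero_of_natDegree_lt (lt_of_le_of_lt hd (by omega)), ht]
        ring
  exact (key n).1

theorem awOp_coeff {t : ℕ → ℂ} (ht0 : t 0 = t₀) (ht1 : t 1 = t₁)
    (ht : ∀ n, t (n + 2) = σ * t (n + 1) - t n) {n : ℕ} {Q : ℂ[X]} (hQ : Q.natDegree ≤ n) :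
    (awOp σ τ g g' t₀ t₁ k Q).natDegree ≤ n ∧
      (awOp σ τ g g' t₀ t₁ k Q).coeff n = t n * Q.coeff n := by
  have e : awOp σ τ g g' t₀ t₁ k Q =
      ∑ i ∈ Finset.range (n + 1), C (Q.coeff i) * awSeq σ τ g g' t₀ t₁ k i := by
    conv_lhs => rw [Q.as_sum_range_C_mul_X_pow' (Nat.lt_succ_of_le hQ)]
    simp only [map_sum, ← smul_eq_C_mul, map_smul, awOp_X_pow]
  have h := awSeq_coeff (τ := τ) (g := g) (g' := g') (k := k) ht0 ht1 ht
  rw [e]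
  constructor
  · refine natDegree_sum_le_of_forall_le _ _ fun i hi => (natDegree_C_mul_le _ _).trans ?_
    have := Finset.mem_range.1 hi
    exact (h i).1.trans (by omega)
  · rw [finsetSum_coeff, Finset.sum_range_succ, Finset.sum_eq_zero, zero_add, coeff_C_mul,
      (h n).2, mul_comm]
    intro i hi
    rw [coeff_C_mul, coeff_eq_zero_of_natDegree_lt
      (lt_of_le_of_lt (h i).1 (Finset.mem_range.1 hi)), mul_zero]

/-- At a zero `y` of its argument the Askey-Wilson operator is a two-point functional. -/
theorem eval_awOp_X_sub_C_mul {y yp ym cp cm : ℂ} (hs : yp + ym = σ * y)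
    (hp : yp * ym = y ^ 2 + τ) (h0 : cp + cm = t₁ * y + k - y * t₀)
    (h1 : cp * yp + cm * ym = σ * y * (t₁ * y + k) - y ^ 2 * t₀ - τ * (t₀ + (g * y + g'))
      - y * (t₁ * y + k)) (R : ℂ[X]) :
    (awOp σ τ g g' t₀ t₁ k ((X - C y) * R)).eval y = cp * R.eval yp + cm * R.eval ym := by
  -- The factor `X - y` kills the inhomogeneity at `y`. The resulting functional of `R` has moments
  -- with a constant-coefficient recursion of characteristic roots `yp`, `ym`; `h0` and `h1` match
  -- the first two moments.
  have rec' : ∀ R : ℂ[X], (awOp σ τ g g' t₀ t₁ k ((X - C y) * (X ^ 2 * R))).eval y =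
      σ * y * (awOp σ τ g g' t₀ t₁ k ((X - C y) * (X * R))).eval y -
        (y ^ 2 + τ) * (awOp σ τ g g' t₀ t₁ k ((X - C y) * R)).eval y := by
    intro R
    have e1 : (X - C y) * (X ^ 2 * R) = X ^ 2 * ((X - C y) * R) := by ring
    have e2 : (X - C y) * (X * R) = X * ((X - C y) * R) := by ring
    rw [e1, e2, awOp_X_sq_mul]
    simp
    ring
  have b0 : awOp σ τ g g' t₀ t₁ k ((X - C y) * X ^ 0) = C t₁ * X + C k - C y * C t₀ := by
    have : (X - C y) * X ^ 0 = X ^ 1 - y • (X ^ 0 : ℂ[X]) := by simp [smul_eq_C_mul]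
    rw [this, map_sub, map_smul, awOp_X_pow, awOp_X_pow, smul_eq_C_mul]; simp [awSeq]
  have b1 : awOp σ τ g g' t₀ t₁ k ((X - C y) * X ^ 1) =
      awSeq σ τ g g' t₀ t₁ k 2 - C y * (C t₁ * X + C k) := by
    have : (X - C y) * X ^ 1 = X ^ 2 - y • (X ^ 1 : ℂ[X]) := by simp [smul_eq_C_mul]; ring
    rw [this, map_sub, map_smul, awOp_X_pow, awOp_X_pow, smul_eq_C_mul]; simp [awSeq]
  have key : ∀ n : ℕ, (awOp σ τ g g' t₀ t₁ k ((X - C y) * X ^ n)).eval y =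
        cp * yp ^ n + cm * ym ^ n ∧
      (awOp σ τ g g' t₀ t₁ k ((X - C y) * X ^ (n + 1))).eval y =
        cp * yp ^ (n + 1) + cm * ym ^ (n + 1) := by
    intro n
    induction n with
    | zero =>
      refine ⟨?_, ?_⟩
      · rw [b0]; simp [h0]
      · rw [zero_add, b1, pow_one, pow_one, h1]; simp [awSeq]; ring
    | succ n ih =>
      refine ⟨ih.2, ?_⟩
      have e1 : (X ^ (n + 1 + 1) : ℂ[X]) = X ^ 2 * X ^ n := by ring
      have e2 : (X ^ (n + 1) : ℂ[X]) = X * X ^ n := by ring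
      rw [e1, rec', ← e2, ih.1, ih.2, ← hs, ← hp]
      ring
  induction R using Polynomial.induction_on' with
  | add p r hp hr => rw [mul_add, map_add, eval_add, hp, hr, eval_add, eval_add]; ring
  | monomial n a =>
    have e3 : monomial n a = a • (X ^ n : ℂ[X]) := by
      rw [← C_mul_X_pow_eq_monomial, smul_eq_C_mul]
    rw [e3, mul_smul_comm, map_smul, eval_smul, (key n).1]
    simp only [eval_smul, eval_pow, eval_X, smul_eq_mul]
    ring

/-- `∏ (X - U_i)` is an eigenvector of the Askey-Wilson operator if its image vanishes at the
distinct points `U_i`. -/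
theorem awOp_prod_eq {t : ℕ → ℂ} (ht0 : t 0 = t₀) (ht1 : t 1 = t₁)
    (ht : ∀ n, t (n + 2) = σ * t (n + 1) - t n) {M : ℕ} {U : Fin M → ℂ}
    (hU : Function.Injective U)
    (hB : ∀ i, (awOp σ τ g g' t₀ t₁ k (∏ j, (X - C (U j)))).eval (U i) = 0) :
    awOp σ τ g g' t₀ t₁ k (∏ j, (X - C (U j))) = t M • ∏ j, (X - C (U j)) := by
  set Q : ℂ[X] := ∏ j, (X - C (U j)) with hQ
  have hm : Q.Monic := monic_prod_X_sub_C _ _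
  have hd : Q.natDegree = M := by rw [hQ, natDegree_finsetProd_X_sub_C_eq_card]; simp
  obtain ⟨h1, h2⟩ := awOp_coeff (τ := τ) (g := g) (g' := g') (k := k) ht0 ht1 ht hd.le
  have hc : Q.coeff M = 1 := by rw [← hd]; exact hm.coeff_natDegree
  rw [hc, mul_one] at h2
  -- The leading terms cancel, so the difference has degree below `M` and vanishes at the `M`
  -- distinct points `U i`.
  refine sub_eq_zero.1 (eq_zero_of_degree_lt_of_eval_finset_eq_zero (Finset.univ.image U) ?_ ?_)
  · rw [Finset.card_image_of_injective _ hU, Finset.card_univ, Fintype.card_fin]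
    refine (degree_lt_iff_coeff_zero _ _).2 fun m hm' => ?_
    rw [coeff_sub, coeff_smul]
    rcases hm'.eq_or_lt with rfl | hlt
    · rw [h2, hc]; simp
    · rw [coeff_eq_zero_of_natDegree_lt (h1.trans_lt hlt),
        coeff_eq_zero_of_natDegree_lt (hd.le.trans_lt hlt)]; simp
  · intro z hz
    obtain ⟨i, -, rfl⟩ := Finset.mem_image.1 hz
    rw [eval_sub, hB i, eval_smul, hQ, eval_prod,
      Finset.prod_eq_zero (Finset.mem_univ i) (by simp)]
    simp
end awOp

/-! ### Matrix entries in the eigenbasis of the first operator -/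

namespace AWParams

/-- The genericity assumptions on the parameters. -/
structure Generic (P : AWParams) : Prop where
  q0 : P.q ≠ 0
  hq : ∀ k : ℕ, 0 < k → P.q ^ k ≠ 1
  b0 : P.b ≠ 0
  c0 : P.c ≠ 0
  bs0 : P.bs ≠ 0
  cs0 : P.cs ≠ 0
  hbc : P.b * P.c = P.bs * P.cs
  ζ0 : P.ζ ≠ 0
  θinj : Function.Injective fun M : Fin (P.d + 1) => P.theta M

/-- The operator `-(q - q⁻¹) ρ⁻¹ (q x y - q⁻¹ y x + ω / (q - q⁻¹))`. -/
def sOp (P : AWParams) {W : Type*} [AddCommGroup W] [Module ℂ W] (x y : Module.End ℂ W) :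
    Module.End ℂ W :=
  (-(P.q - P.q⁻¹) * P.rho⁻¹) •
    (P.q • (x * y) - P.q⁻¹ • (y * x) + (P.omega / (P.q - P.q⁻¹)) • 1)

/-- Two operators satisfying the Askey-Wilson relations and acting irreducibly, the first one
diagonal in the basis `B` and the second one with the trace of its expected spectrum. -/
structure IsAWPair (P : AWParams) {W : Type*} [AddCommGroup W] [Module ℂ W]
    (x y : Module.End ℂ W) (B : Module.Basis (Fin (P.d + 1)) ℂ W) : Prop extends Generic P where
  rel1 : x * x * y - (P.q ^ 2 + (P.q ^ 2)⁻¹) • (x * y * x) + y * x * x =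
    P.rho • y + P.omega • x + P.eta • 1
  rel2 : y * y * x - (P.q ^ 2 + (P.q ^ 2)⁻¹) • (y * x * y) + x * y * y =
    P.rho • x + P.omega • y + P.etaStar • 1
  eig : ∀ M, x (B M) = P.theta M • B M
  irr : ∀ U : Submodule ℂ W, (∀ w ∈ U, x w ∈ U) → (∀ w ∈ U, y w ∈ U) → U = ⊥ ∨ U = ⊤
  tr : LinearMap.trace ℂ W y = ∑ N ∈ Finset.range (P.d + 1), P.thetaStar N

section scalars
variable {P : AWParams}

theorem Generic.pow_ne (h : P.Generic) {n : ℕ} (hn : 0 < n) : P.q ^ n - (P.q ^ n)⁻¹ ≠ 0 := by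
  intro h'
  have h0 := pow_ne_zero n h.q0
  apply h.hq (n * 2) (by omega)
  rw [pow_mul]
  field_simp at h'
  linear_combination h'

theorem Generic.pow_add_ne (h : P.Generic) (n : ℕ) : P.q ^ n + (P.q ^ n)⁻¹ ≠ 0 := by
  intro h'
  have h0 := pow_ne_zero n h.q0
  rcases n.eq_zero_or_pos with rfl | hn
  · norm_num at h'
  apply h.hq (n * 4) (by omega)
  rw [pow_mul]
  field_simp at h'
  linear_combination ((P.q ^ n) ^ 2 - 1) * h'

theorem Generic.sub_ne (h : P.Generic) : P.q - P.q⁻¹ ≠ 0 := by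
  simpa using h.pow_ne one_pos

theorem Generic.add_ne (h : P.Generic) : P.q + P.q⁻¹ ≠ 0 := by
  simpa using h.pow_add_ne 1

theorem Generic.rho_ne (h : P.Generic) : P.rho ≠ 0 :=
  neg_ne_zero.2 (mul_ne_zero (mul_ne_zero h.b0 h.c0) (pow_ne_zero 2 (h.pow_ne two_pos)))

theorem Generic.theta_ne (h : P.Generic) {i j : ℕ} (hi : i ≤ P.d) (hj : j ≤ P.d) (hij : i ≠ j) :
    P.theta i - P.theta j ≠ 0 := by
  intro e
  have := @h.θinj ⟨i, by omega⟩ ⟨j, by omega⟩ (sub_eq_zero.1 e)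
  exact hij (by simpa using this)

theorem Generic.theta_one_sub (h : P.Generic) :
    P.theta 0 - P.theta 1 = -(P.q - P.q⁻¹) * (P.b * P.q - P.c * P.q⁻¹) := by
  have := h.q0
  simp only [theta]; field_simp; ring

theorem Generic.theta_rec (h : P.Generic) (n : ℕ) :
    P.theta (n + 2) = (P.q ^ 2 + (P.q ^ 2)⁻¹) * P.theta (n + 1) - P.theta n := by
  have := h.q0
  simp only [theta]; field_simp; ring

/-- The coefficient of `y` in the `(M, K)` entry of the first relation does not vanish above the
first superdiagonal. -/
theorem Generic.entry_ne (h : P.Generic) {M K : ℕ} (hMK : M + 2 ≤ K) (hK : K ≤ P.d) :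
    P.theta K ^ 2 - (P.q ^ 2 + (P.q ^ 2)⁻¹) * P.theta M * P.theta K + P.theta M ^ 2 - P.rho ≠ 0 := by
  have h0 := h.q0
  -- The expression factors as `(θ_K - θ_{M+1})(θ_K - θ_{M-1})`. For `M = 0` the value `θ_{-1}` is
  -- outside the list of distinct eigenvalues, and `θ_K - θ_{-1}` is compared with `θ_{K-1} - θ_0`
  -- instead.
  rcases M with _ | M
  · obtain ⟨j, rfl⟩ : ∃ j, K = j + 2 := ⟨K - 2, by omega⟩
    have e1 : P.theta (j + 2) ^ 2 - (P.q ^ 2 + (P.q ^ 2)⁻¹) * P.theta 0 * P.theta (j + 2) +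
        P.theta 0 ^ 2 - P.rho = (P.theta (j + 2) - P.theta 1) *
          (P.theta (j + 2) - (P.b * (P.q ^ 2)⁻¹ + P.c * P.q ^ 2)) := by
      generalize P.theta (j + 2) = t
      simp only [theta, rho]; field_simp; ring
    have e2 : (P.theta (j + 2) - (P.b * (P.q ^ 2)⁻¹ + P.c * P.q ^ 2)) *
        (P.q ^ (j + 1) - (P.q ^ (j + 1))⁻¹) =
          (P.theta (j + 1) - P.theta 0) * (P.q ^ (j + 3) - (P.q ^ (j + 3))⁻¹) := by
      simp only [theta]; field_simp; ring
    have h1 : (P.theta (j + 1) - P.theta 0) * (P.q ^ (j + 3) - (P.q ^ (j + 3))⁻¹) ≠ 0 :=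
      mul_ne_zero (h.theta_ne (by omega) (by omega) (by omega)) (h.pow_ne (by omega))
    rw [e1]
    refine mul_ne_zero (h.theta_ne hK (by omega) (by omega)) fun h2 => h1 ?_
    rw [← e2, h2, zero_mul]
  · have e1 : P.theta K ^ 2 - (P.q ^ 2 + (P.q ^ 2)⁻¹) * P.theta (M + 1) * P.theta K +
        P.theta (M + 1) ^ 2 - P.rho =
          (P.theta K - P.theta (M + 2)) * (P.theta K - P.theta M) := by
      generalize P.theta K = t
      simp only [theta, rho]; field_simp; ring
    rw [e1]
    exact mul_ne_zero (h.theta_ne hK (by omega) (by omega)) (h.theta_ne hK (by omega) (by omega))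

end scalars

namespace IsAWPair
variable {P : AWParams} {W : Type*} [AddCommGroup W] [Module ℂ W]
  {x y : Module.End ℂ W} {B : Module.Basis (Fin (P.d + 1)) ℂ W}

theorem repr_x (h : P.IsAWPair x y B) (w : W) (K : Fin (P.d + 1)) :
    B.repr (x w) K = P.theta K * B.repr w K := by
  conv_lhs => rw [← B.sum_repr w]
  simp only [map_sum, map_smul, h.eig, Finsupp.coe_finsetSum, Finset.sum_apply,
    Finsupp.smul_apply, Module.Basis.repr_self, smul_eq_mul]
  rw [Finset.sum_eq_single K]
  · simp [mul_comm]
  · intro M _ hM; simp [hM]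
  · simp

theorem _root_.Module.Basis.repr_end_apply {ι : Type*} [Fintype ι] (B : Module.Basis ι ℂ W)
    (S : Module.End ℂ W) (w : W) (K : ι) :
    B.repr (S w) K = ∑ M, B.repr w M * B.repr (S (B M)) K := by
  conv_lhs => rw [← B.sum_repr w]
  simp only [map_sum, map_smul, Finsupp.coe_finsetSum, Finset.sum_apply,
    Finsupp.smul_apply, smul_eq_mul]

theorem entry (h : P.IsAWPair x y B) (M K : Fin (P.d + 1)) :
    (P.theta K ^ 2 - (P.q ^ 2 + (P.q ^ 2)⁻¹) * P.theta M * P.theta K + P.theta M ^ 2 - P.rho) *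
      B.repr (y (B M)) K = if M = K then P.omega * P.theta M + P.eta else 0 := by
  have := congrArg (fun f : Module.End ℂ W => B.repr (f (B M)) K) h.rel1
  simp only [Module.End.mul_apply, LinearMap.add_apply, LinearMap.sub_apply, LinearMap.smul_apply,
    Module.End.one_apply, h.eig, map_smul, map_add, map_sub, Finsupp.add_apply, Finsupp.sub_apply,
    Finsupp.smul_apply, h.repr_x, smul_eq_mul, Module.Basis.repr_self, Finsupp.single_apply] at this
  split_ifs at this ⊢ <;> linear_combination this

theorem entry_eq_zero (h : P.IsAWPair x y B) {M K : Fin (P.d + 1)} (hMK : (M : ℕ) + 2 ≤ K) :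
    B.repr (y (B M)) K = 0 := by
  have := h.entry M K
  rw [if_neg (by intro e; subst e; omega)] at this
  exact (mul_eq_zero.1 this).resolve_left (h.entry_ne hMK (by omega))

theorem repr_sOp (h : P.IsAWPair x y B) (M K : Fin (P.d + 1)) :
    B.repr (P.sOp x y (B M)) K = -(P.q - P.q⁻¹) * P.rho⁻¹ *
      ((P.q * P.theta K - P.q⁻¹ * P.theta M) * B.repr (y (B M)) K +
        if M = K then P.omega / (P.q - P.q⁻¹) else 0) := by
  simp only [sOp, Module.End.mul_apply, LinearMap.add_apply, LinearMap.sub_apply,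
    LinearMap.smul_apply, Module.End.one_apply, h.eig, map_smul, map_add, map_sub,
    Finsupp.add_apply, Finsupp.sub_apply,
    Finsupp.smul_apply, h.repr_x, smul_eq_mul, Module.Basis.repr_self, Finsupp.single_apply]
  split_ifs <;> ring

theorem repr_sOp_eq_zero (h : P.IsAWPair x y B) {M K : Fin (P.d + 1)} (hMK : (M : ℕ) + 2 ≤ K) :
    B.repr (P.sOp x y (B M)) K = 0 := by
  rw [h.repr_sOp, h.entry_eq_zero hMK, if_neg (by intro e; subst e; omega)]
  ring

theorem repr_sOp_succ (h : P.IsAWPair x y B) {M K : Fin (P.d + 1)} (hMK : (K : ℕ) = M + 1) :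
    B.repr (P.sOp x y (B M)) K = -(P.q - P.q⁻¹) * P.rho⁻¹ *
      (P.b * P.q ^ (2 * (M : ℕ) + 1) * (P.q ^ 2 - (P.q ^ 2)⁻¹)) * B.repr (y (B M)) K := by
  rw [h.repr_sOp, if_neg (by intro e; subst e; omega), hMK]
  have e : P.q * P.theta (M + 1) - P.q⁻¹ * P.theta M =
      P.b * P.q ^ (2 * (M : ℕ) + 1) * (P.q ^ 2 - (P.q ^ 2)⁻¹) := by
    have := h.q0
    simp only [theta]; field_simp; ring
  rw [e]; ring

/-- If this entry vanished, the span of `B 0, …, B M` would be a proper nonzero subspace stable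
under both operators. -/
theorem entry_succ_ne (h : P.IsAWPair x y B) {M K : Fin (P.d + 1)} (hMK : (K : ℕ) = M + 1) :
    B.repr (y (B M)) K ≠ 0 := by
  intro h0
  let U : Submodule ℂ W :=
    { carrier := {w | ∀ J : Fin (P.d + 1), M < J → B.repr w J = 0}
      add_mem' := fun {a b} ha hb J hJ => by simp [ha J hJ, hb J hJ]
      zero_mem' := fun J _ => by simp
      smul_mem' := fun c a ha J hJ => by simp [ha J hJ] }
  have hU : U = ⊥ ∨ U = ⊤ := by
    refine h.irr U (fun w hw J hJ => ?_) (fun w hw J hJ => ?_)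
    · rw [h.repr_x, hw J hJ, mul_zero]
    · rw [B.repr_end_apply]
      refine Finset.sum_eq_zero fun L _ => ?_
      rcases lt_or_ge M L with hL | hL
      · rw [hw L hL, zero_mul]
      · rw [Fin.lt_def] at hJ
        rw [Fin.le_def] at hL
        by_cases hc : (L : ℕ) + 2 ≤ J
        · rw [h.entry_eq_zero hc, mul_zero]
        · obtain rfl : L = M := Fin.ext (by omega)
          obtain rfl : J = K := Fin.ext (by omega)
          rw [h0, mul_zero]
  rcases hU with hU | hU
  · have : B M ∈ U := fun J hJ => by simp [hJ.ne]
    rw [hU, Submodule.mem_bot] at this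
    exact B.ne_zero M this
  · have : B K ∈ U := hU ▸ Submodule.mem_top
    have := this K (Fin.lt_def.2 (by omega))
    simp at this

/-- `sOp` and the first operator satisfy a homogeneous Askey-Wilson relation. -/
theorem sOp_rel (h : P.IsAWPair x y B) :
    x * P.sOp x y * P.sOp x y = (P.q ^ 2 + (P.q ^ 2)⁻¹) • (P.sOp x y * x * P.sOp x y) -
      P.sOp x y * P.sOp x y * x - ((P.q - P.q⁻¹) ^ 2) •
        (x + (P.rho⁻¹ * P.eta) • P.sOp x y + (P.rho⁻¹ * P.etaStar) • 1) := by
  have hq0 := h.q0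
  have hs := h.sub_ne
  have hr := h.rho_ne
  obtain ⟨T, hT⟩ : ∃ T, T = P.q • (x * y) - P.q⁻¹ • (y * x) := ⟨_, rfl⟩
  -- With `T = [x, y]_q`, the first relation expresses `ρ y` through `[T, x]_q` and `x`, and the
  -- second one is a formula for `[y, T]_q`. Substituting the former into the latter eliminates `y`.
  have hy : P.rho • y = -(P.q • (T * x) - P.q⁻¹ • (x * T) + P.omega • x + P.eta • 1) := by
    have := h.rel1
    rw [hT]
    simp only [sub_mul, mul_sub, smul_mul_assoc, mul_smul_comm, ← mul_assoc] at this ⊢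
    have e : P.rho • y = x * x * y - (P.q ^ 2 + (P.q ^ 2)⁻¹) • (x * y * x) + y * x * x
      - P.omega • x - P.eta • (1 : Module.End ℂ W) := by rw [this]; module
    rw [e]
    match_scalars <;> field_simp <;> ring
  have h2 : P.q • (y * T) - P.q⁻¹ • (T * y) = -(P.rho • x + P.omega • y + P.etaStar • 1) := by
    rw [← h.rel2, hT]
    simp only [sub_mul, mul_sub, smul_mul_assoc, mul_smul_comm, ← mul_assoc]
    match_scalars <;> field_simp <;> ring
  have h3 : x * T * T = (P.q ^ 2 + (P.q ^ 2)⁻¹) • (T * x * T) - T * T * x +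
      (P.omega * (P.q - P.q⁻¹)) • (T * x + x * T) + ((P.q - P.q⁻¹) * P.eta) • T +
      (P.omega ^ 2 - P.rho ^ 2) • x + (P.omega * P.eta - P.rho * P.etaStar) • 1 := by
    have h4 : P.q • ((P.rho • y) * T) - P.q⁻¹ • (T * (P.rho • y)) + P.rho ^ 2 • x +
        P.omega • (P.rho • y) + (P.rho * P.etaStar) • 1 = 0 := by
      have := congrArg (fun f => P.rho • f) h2
      simp only [smul_mul_assoc, mul_smul_comm] at this ⊢
      rw [← sub_eq_zero] at this
      rw [← this]
      module
    rw [hy] at h4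
    simp only [sub_mul, mul_sub, add_mul, mul_add, neg_mul, mul_neg, smul_mul_assoc,
      mul_smul_comm, ← mul_assoc, mul_one, one_mul] at h4 ⊢
    rw [← sub_eq_zero, ← h4]
    match_scalars <;> field_simp <;> ring
  -- The constant shift from `T` to `sOp` absorbs the term `T x + x T`.
  have hS : P.sOp x y = (-(P.q - P.q⁻¹) * P.rho⁻¹) • T - (P.rho⁻¹ * P.omega) • 1 := by
    have hs' : P.q ^ 2 - 1 ≠ 0 := sub_ne_zero.2 (h.hq 2 two_pos)
    rw [sOp, ← hT]
    match_scalars <;> field_simp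
  rw [hS]
  simp only [sub_mul, mul_sub, smul_mul_assoc, mul_smul_comm, mul_one, one_mul]
  rw [h3]
  match_scalars <;> field_simp <;> ring

end IsAWPair
-- The corner diagonal entry and the action on polynomials in `sOp`
section scalars
variable {P : AWParams}

theorem Generic.sum_thetaStar (h : P.Generic) (n : ℕ) :
    (∑ N ∈ Finset.range (n + 1), P.thetaStar N) * (P.q - P.q⁻¹) =
      (P.bs * P.q ^ n + P.cs * (P.q ^ n)⁻¹) * (P.q ^ (n + 1) - (P.q ^ (n + 1))⁻¹) := by
  have h0 := h.q0
  induction n with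
  | zero => simp [thetaStar]
  | succ n ih =>
    rw [Finset.sum_range_succ, add_mul, ih]
    simp only [thetaStar]; field_simp; ring

theorem Generic.sq_add_one_ne (h : P.Generic) : P.q ^ 2 + 1 ≠ 0 := by
  intro e
  have h0 := h.q0
  apply h.add_ne
  field_simp
  rw [mul_zero]
  exact e

/-- The subleading coefficient of the Askey-Wilson operator on `X`. -/
def subleading (P : AWParams) : ℂ :=
  -(P.q - P.q⁻¹) / (P.q + P.q⁻¹) *
    (P.zz * (P.b * P.q ^ (P.d + 1) - P.c * (P.q ^ (P.d + 1))⁻¹) +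
      P.bcStar * (P.q ^ P.d - (P.q ^ P.d)⁻¹))

end scalars

namespace IsAWPair
variable {P : AWParams} {W : Type*} [AddCommGroup W] [Module ℂ W]
  {x y : Module.End ℂ W} {B : Module.Basis (Fin (P.d + 1)) ℂ W}

/-- Both sides of the diagonal entry of the first relation share a factor that vanishes at index `0`
but not at `M > 0`, so it can be cancelled here. -/
theorem entry_diag_of_degenerate (h : P.IsAWPair x y B) (hb : P.b = P.c * P.q ^ 2)
    {M : Fin (P.d + 1)} (hM : 0 < (M : ℕ)) :
    B.repr (y (B M)) M * ((P.q ^ ((M : ℕ) + 1) + (P.q ^ ((M : ℕ) + 1))⁻¹) *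
      (P.q ^ (M : ℕ) + (P.q ^ (M : ℕ))⁻¹)) = -(P.qq * (P.c * P.q * P.zz - P.bcStar)) := by
  have h0 := h.q0
  have hs := h.sub_ne
  have hc := h.c0
  have h1 := h.pow_ne hM
  have h2 := h.pow_ne (Nat.succ_pos M)
  have key := h.entry M M
  rw [if_pos rfl] at key
  have hbc : P.bc = P.c * P.q * P.qq := by
    simp only [AWParams.bc, qq, hb]; field_simp; ring
  have e1 : P.theta M ^ 2 - (P.q ^ 2 + (P.q ^ 2)⁻¹) * P.theta M * P.theta M + P.theta M ^ 2 - P.rho =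
      -((P.q - P.q⁻¹) ^ 2 * (P.c * P.q) ^ 2 * (P.q ^ (M : ℕ) - (P.q ^ (M : ℕ))⁻¹) *
        (P.q ^ ((M : ℕ) + 1) - (P.q ^ ((M : ℕ) + 1))⁻¹)) *
      ((P.q ^ ((M : ℕ) + 1) + (P.q ^ ((M : ℕ) + 1))⁻¹) *
      (P.q ^ (M : ℕ) + (P.q ^ (M : ℕ))⁻¹)) := by
    simp only [theta, rho, hb]; field_simp; ring
  have e2 : P.omega * P.theta M + P.eta =
      -((P.q - P.q⁻¹) ^ 2 * (P.c * P.q) ^ 2 * (P.q ^ (M : ℕ) - (P.q ^ (M : ℕ))⁻¹) *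
        (P.q ^ ((M : ℕ) + 1) - (P.q ^ ((M : ℕ) + 1))⁻¹)) *
      -(P.qq * (P.c * P.q * P.zz - P.bcStar)) := by
    have hq := h.sq_add_one_ne
    simp only [theta, omega, eta, hbc, hb]
    generalize P.qq = κ
    generalize P.zz = z
    generalize P.bcStar = es
    field_simp
    ring
  rw [e1, e2, mul_assoc] at key
  have := mul_left_cancel₀ (neg_ne_zero.2 (mul_ne_zero (mul_ne_zero (mul_ne_zero
    (pow_ne_zero 2 hs) (pow_ne_zero 2 (mul_ne_zero hc h0))) h1) h2)) key
  rw [← this, mul_comm]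

/-- The `(0, 0)` entry of the first relation gives this after cancelling `b q⁻¹ - c q`. If that
factor is zero the relation says nothing, and the trace of `y` supplies the value. -/
theorem entry_zero (h : P.IsAWPair x y B) :
    B.repr (y (B 0)) 0 * (P.b * P.q - P.c * P.q⁻¹) =
      P.b * P.c * P.zz * (P.q ^ P.d - (P.q ^ P.d)⁻¹) +
        P.bcStar * (P.b * P.q ^ (P.d + 1) - P.c * (P.q ^ (P.d + 1))⁻¹) := by
  have h0 := h.q0
  have hs := h.sub_ne
  have hp := h.add_ne
  have hq := h.sq_add_one_ne
  have hq' : P.q ^ 2 - 1 ≠ 0 := sub_ne_zero.2 (h.hq 2 two_pos)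
  by_cases hdeg : P.b * P.q⁻¹ - P.c * P.q = 0
  · have hb : P.b = P.c * P.q ^ 2 := by
      field_simp at hdeg
      linear_combination hdeg
    have htr := h.tr
    rw [LinearMap.trace_eq_matrix_trace ℂ B y, Matrix.trace] at htr
    simp only [Matrix.diag_apply, LinearMap.toMatrix_apply] at htr
    rw [Fin.sum_univ_succ] at htr
    -- The diagonal entries at positive indices are differences of consecutive values of `r`, so
    -- their sum telescopes and the trace isolates the entry at `0`.
    set r : ℕ → ℂ := fun n => (P.q ^ n - (P.q ^ n)⁻¹) / (P.q ^ n + (P.q ^ n)⁻¹) with hr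
    have hdiag : ∀ i : Fin P.d, B.repr (y (B i.succ)) i.succ =
        -(P.qq * (P.c * P.q * P.zz - P.bcStar)) / (2 * (P.q - P.q⁻¹)) *
          (r (i + 1 + 1) - r (i + 1)) := by
      intro i
      have := h.entry_diag_of_degenerate hb (M := i.succ) (by simp)
      rw [← this, Fin.val_succ]
      have h1 := h.pow_add_ne (i + 1)
      have h2 := h.pow_add_ne (i + 1 + 1)
      generalize B.repr (y (B i.succ)) i.succ = Y
      have e : r (i + 1 + 1) - r (i + 1) = 2 * (P.q - P.q⁻¹) /
          ((P.q ^ ((i : ℕ) + 1 + 1) + (P.q ^ ((i : ℕ) + 1 + 1))⁻¹) *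
            (P.q ^ ((i : ℕ) + 1) + (P.q ^ ((i : ℕ) + 1))⁻¹)) := by
        simp only [hr]
        rw [div_sub_div _ _ h2 h1]
        congr 1
        field_simp
        ring
      rw [e]
      generalize P.q ^ ((i : ℕ) + 1 + 1) + (P.q ^ ((i : ℕ) + 1 + 1))⁻¹ = a at *
      generalize P.q ^ ((i : ℕ) + 1) + (P.q ^ ((i : ℕ) + 1))⁻¹ = b at *
      generalize P.q - P.q⁻¹ = c at *
      field_simp
    simp only [hdiag] at htr
    rw [← Finset.mul_sum, Fin.sum_univ_eq_sum_range (fun i => r (i + 1 + 1) - r (i + 1)),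
      Finset.sum_range_sub (fun i => r (i + 1))] at htr
    have hsum := h.sum_thetaStar P.d
    rw [← htr] at hsum
    have hκ : P.qq * r (P.d + 1) = P.q ^ (P.d + 1) - (P.q ^ (P.d + 1))⁻¹ := by
      simp only [hr, qq]
      exact mul_div_cancel₀ _ (h.pow_add_ne _)
    have h1 : r 1 = (P.q - P.q⁻¹) / (P.q + P.q⁻¹) := by simp [hr]
    have hes : P.bs * P.q ^ P.d + P.cs * (P.q ^ P.d)⁻¹ = P.bcStar := rfl
    rw [zero_add, h1, hes] at hsum
    have hsum' : 2 * B.repr (y (B 0)) 0 * (P.q - P.q⁻¹) =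
        2 * P.bcStar * (P.q ^ (P.d + 1) - (P.q ^ (P.d + 1))⁻¹) +
          (P.c * P.q * P.zz - P.bcStar) * ((P.q ^ (P.d + 1) - (P.q ^ (P.d + 1))⁻¹) -
            P.qq * ((P.q - P.q⁻¹) / (P.q + P.q⁻¹))) := by
      generalize P.q - P.q⁻¹ = s at *
      have e : ∀ Y g t : ℂ, (Y + -(P.qq * g) / (2 * s) * t) * s = Y * s - P.qq * g * t / 2 := by
        intro Y g t
        field_simp
        ring
      rw [e] at hsum
      linear_combination 2 * hsum + (P.c * P.q * P.zz - P.bcStar) * hκ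
    rw [← mul_right_inj' (mul_ne_zero two_ne_zero hs)]
    have e3 : 2 * (P.q - P.q⁻¹) * (B.repr (y (B 0)) 0 * (P.b * P.q - P.c * P.q⁻¹)) =
        (2 * B.repr (y (B 0)) 0 * (P.q - P.q⁻¹)) * (P.b * P.q - P.c * P.q⁻¹) := by ring
    rw [e3, hsum', hb]
    simp only [qq]
    generalize P.zz = z
    generalize P.bcStar = es
    field_simp
    ring
  · have key := h.entry 0 0
    rw [if_pos rfl] at key
    have e1 : P.theta 0 ^ 2 - (P.q ^ 2 + (P.q ^ 2)⁻¹) * P.theta 0 * P.theta 0 + P.theta 0 ^ 2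
        - P.rho = -((P.q - P.q⁻¹) ^ 2 * (P.b * P.q⁻¹ - P.c * P.q)) *
          (P.b * P.q - P.c * P.q⁻¹) := by
      simp only [theta, rho]; field_simp; ring
    have e2 : P.omega * P.theta 0 + P.eta =
        -((P.q - P.q⁻¹) ^ 2 * (P.b * P.q⁻¹ - P.c * P.q)) *
        (P.b * P.c * P.zz * (P.q ^ P.d - (P.q ^ P.d)⁻¹) +
          P.bcStar * (P.b * P.q ^ (P.d + 1) - P.c * (P.q ^ (P.d + 1))⁻¹)) := by
      simp only [theta, omega, eta, AWParams.bc, qq]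
      generalize P.zz = z
      generalize P.bcStar = es
      field_simp
      ring
    simp only [Fin.val_zero] at key
    rw [e1, e2, mul_assoc] at key
    rw [← mul_left_cancel₀ (neg_ne_zero.2 (mul_ne_zero (pow_ne_zero 2 hs) hdeg)) key, mul_comm]

/-- Kept as a product because `θ₁` is not among the distinct eigenvalues when `d = 0`, where `θ₀ -
θ₁` may vanish. -/
theorem repr_sOp_zero (h : P.IsAWPair x y B) :
    B.repr (P.sOp x y (B 0)) 0 * (P.theta 0 - P.theta 1) = P.subleading := by
  have h0 := h.q0
  have hs := h.sub_ne
  have hb := h.b0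
  have hc := h.c0
  have hq := h.sq_add_one_ne
  have hq' : P.q ^ 2 - 1 ≠ 0 := sub_ne_zero.2 (h.hq 2 two_pos)
  rw [h.repr_sOp, if_pos rfl, h.theta_one_sub]
  have e : -(P.q - P.q⁻¹) * P.rho⁻¹ * ((P.q * P.theta (0 : Fin (P.d + 1)) -
      P.q⁻¹ * P.theta (0 : Fin (P.d + 1))) * B.repr (y (B 0)) 0 + P.omega / (P.q - P.q⁻¹)) *
      (-(P.q - P.q⁻¹) * (P.b * P.q - P.c * P.q⁻¹)) =
      (P.q - P.q⁻¹) ^ 2 * P.rho⁻¹ * ((P.q - P.q⁻¹) * P.theta 0 *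
        (B.repr (y (B 0)) 0 * (P.b * P.q - P.c * P.q⁻¹)) +
          P.omega / (P.q - P.q⁻¹) * (P.b * P.q - P.c * P.q⁻¹)) := by
    simp only [Fin.val_zero]; ring
  have e4 : P.q ^ 4 - 1 ≠ 0 := sub_ne_zero.2 (h.hq 4 (by norm_num))
  have er : P.rho = -(P.b * P.c * (P.q - P.q⁻¹) ^ 2 * (P.q + P.q⁻¹) ^ 2) := by
    simp only [rho]; field_simp; ring
  rw [e, h.entry_zero, er]
  simp only [theta, omega, AWParams.bc, qq, subleading]
  generalize P.zz = z
  generalize P.bcStar = es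
  field_simp
  ring

/-- The vector `sOp (B 0)` has components only along `B 0` and `B 1`; the difference between `θ₀`
and `θ₁` on the first of these is the subleading term. -/
theorem x_sOp_zero (h : P.IsAWPair x y B) :
    x (P.sOp x y (B 0)) = P.theta 1 • P.sOp x y (B 0) + P.subleading • B 0 := by
  refine B.ext_elem fun K => ?_
  rw [h.repr_x, ← h.repr_sOp_zero]
  simp only [map_add, map_smul, Finsupp.add_apply, Finsupp.smul_apply, smul_eq_mul,
    Module.Basis.repr_self]
  rcases Nat.lt_or_ge K 2 with hK | hK
  · obtain hK | hK : (K : ℕ) = 0 ∨ (K : ℕ) = 1 := by omega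
    · obtain rfl : K = 0 := Fin.ext hK
      simp
      ring
    · rw [hK, Finsupp.single_apply, if_neg (by rintro rfl; simp at hK)]
      ring
  · rw [h.repr_sOp_eq_zero (by simpa using hK), Finsupp.single_apply,
      if_neg (by rintro rfl; simp at hK)]
    ring

/-- Each factor raises the highest index by at most one. The constants `U j` do not affect the top
component, which collects one superdiagonal entry per factor. -/
theorem repr_aeval_prod (h : P.IsAWPair x y B) (n : ℕ) (hn : n < P.d + 1) (U : Fin n → ℂ) :
    (∀ K : Fin (P.d + 1), n < K →
      B.repr (aeval (P.sOp x y) (∏ j, (X - C (U j))) (B 0)) K = 0) ∧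
    B.repr (aeval (P.sOp x y) (∏ j, (X - C (U j))) (B 0)) ⟨n, hn⟩ =
      ∏ k : Fin n, B.repr (P.sOp x y (B ⟨k, by omega⟩)) ⟨k + 1, by omega⟩ := by
  induction n with
  | zero =>
    constructor
    · intro K hK
      have : (0 : Fin (P.d + 1)) ≠ K := by rintro rfl; simp at hK
      simp [this]
    · simp
  | succ n ih =>
    obtain ⟨i1, i2⟩ := ih (by omega) (fun j => U j.castSucc)
    rw [Fin.prod_univ_castSucc, mul_comm, map_mul, Module.End.mul_apply]
    set w := aeval (P.sOp x y) (∏ j : Fin n, (X - C (U j.castSucc))) (B 0)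
    have e : ∀ K : Fin (P.d + 1), n < K →
        B.repr (aeval (P.sOp x y) (X - C (U (Fin.last n))) w) K =
          B.repr w ⟨n, by omega⟩ * B.repr (P.sOp x y (B ⟨n, by omega⟩)) K := by
      intro K hK
      simp only [map_sub, aeval_X, aeval_C, LinearMap.sub_apply, Finsupp.sub_apply,
        Module.algebraMap_end_apply, map_smul, Finsupp.smul_apply, i1 K hK, smul_zero, sub_zero]
      rw [B.repr_end_apply, Finset.sum_eq_single ⟨n, by omega⟩]
      · intro L _ hL
        rcases lt_or_ge n L with hL' | hL'
        · rw [i1 L hL', zero_mul]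
        · have : (L : ℕ) ≠ n := fun hh => hL (Fin.ext hh)
          rw [h.repr_sOp_eq_zero (by omega), mul_zero]
      · simp
    constructor
    · intro K hK
      rw [e K (by omega), h.repr_sOp_eq_zero (by simp; omega), mul_zero]
    · rw [e _ (by simp), i2, Fin.prod_univ_castSucc]
      rfl

end IsAWPair
-- Bethe equations as vanishing of the Askey-Wilson operator
section scalars
variable {P : AWParams}

/-- This identity turns `f` and `h` into ratios of differences of symmetrized roots, so their
products become values of `∏ (X - U_j)` at shifted points. -/
theorem Generic.symRoot_sub (h : P.Generic) {u v : ℂ} (hu : u ≠ 0) (hv : v ≠ 0) :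
    bfun (P.q * u * v) * bfun (u / v) = (P.q + P.q⁻¹) * (P.symRoot u - P.symRoot v) := by
  have h0 := h.q0
  have hp := h.add_ne
  have e : ∀ w, (P.q + P.q⁻¹) * P.symRoot w = P.q * w ^ 2 + P.q⁻¹ * (w ^ 2)⁻¹ := fun w =>
    mul_div_cancel₀ _ hp
  rw [mul_sub, e, e]
  simp only [bfun]; field_simp; ring

theorem bfun_inv (x : ℂ) : bfun x⁻¹ = -bfun x := by simp [bfun]

theorem Generic.f_eq (h : P.Generic) {u v : ℂ} (hu : u ≠ 0) (hv : v ≠ 0) :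
    P.f u v = (P.symRoot (u / P.q) - P.symRoot v) / (P.symRoot u - P.symRoot v) := by
  have h0 := h.q0
  have e1 := h.symRoot_sub hu hv
  have e2 := h.symRoot_sub (div_ne_zero hu h0) hv
  rw [show P.q * (u / P.q) * v = u * v by field_simp,
    show u / P.q / v = (P.q * v / u)⁻¹ by field_simp, bfun_inv] at e2
  rw [show u / v = (v / u)⁻¹ by field_simp, bfun_inv] at e1
  rw [f, ← mul_div_mul_left (P.symRoot (u / P.q) - P.symRoot v) _ h.add_ne, ← e1, ← e2,
    mul_neg, mul_neg, neg_div_neg_eq]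
  congr 1 <;> ring

theorem Generic.h_eq (h : P.Generic) {u v : ℂ} (hu : u ≠ 0) (hv : v ≠ 0) :
    P.h u v = (P.symRoot (P.q * u) - P.symRoot v) / (P.symRoot u - P.symRoot v) := by
  have h0 := h.q0
  have e1 := h.symRoot_sub hu hv
  have e2 := h.symRoot_sub (mul_ne_zero h0 hu) hv
  rw [AWParams.h, ← mul_div_mul_left (P.symRoot (P.q * u) - P.symRoot v) _ h.add_ne, ← e1, ← e2]
  congr 3; ring

theorem Generic.Lam1_eq (h : P.Generic) {u : ℂ} (hu : u ≠ 0) :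
    P.Lam1 (-1) u = u * (P.q ^ (P.d + 1))⁻¹ *
      ((P.q ^ (P.d + 1)) ^ 2 * u ^ 2 + (u ^ 2)⁻¹ - P.q ^ (P.d + 1) * P.zz) *
      (P.c * u ^ 2 * (P.q ^ P.d)⁻¹ + P.b * P.q ^ P.d * (u ^ 2)⁻¹ + P.bcStar) := by
  have h0 := h.q0
  have hcs := h.cs0
  have hζ := h.ζ0
  have hbs : P.bs = P.b * P.c / P.cs := by rw [h.hbc]; field_simp
  have e1 : (1 - (-1 : ℤ)) / 2 = 1 := by norm_num
  have e2 : (1 + (-1 : ℤ)) / 2 = 0 := by norm_num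
  simp only [Lam1, e1, e2, zpow_one, zpow_zero, zpow_neg, zz, bcStar, hbs]
  generalize P.q ^ (P.d + 1) = R
  field_simp
  ring

theorem Generic.Lam2_eq (h : P.Generic) {u : ℂ} (hu : u ≠ 0) :
    P.Lam2 (-1) u = bfun (u ^ 2) * u * (P.q ^ (P.d + 1))⁻¹ / bfun (P.q * u ^ 2) *
      ((P.q ^ P.d * P.q⁻¹) ^ 2 * (u ^ 2)⁻¹ + u ^ 2 - P.q ^ P.d * P.q⁻¹ * P.zz) *
      (P.q ^ 4 * P.b * u ^ 2 * P.q ^ P.d + P.c * (P.q ^ P.d)⁻¹ * (u ^ 2)⁻¹ +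
        P.q ^ 2 * P.bcStar) := by
  have h0 := h.q0
  have hcs := h.cs0
  have hζ := h.ζ0
  have hbs : P.bs = P.b * P.c / P.cs := by rw [h.hbc]; field_simp
  have e1 : (1 - (-1 : ℤ)) / 2 = 1 := by norm_num
  have e2 : (1 + (-1 : ℤ)) / 2 = 0 := by norm_num
  simp only [Lam2, e1, e2, zpow_one, zpow_zero, zpow_neg, zz, bcStar, hbs, zpow_sub₀ h0,
    zpow_natCast]
  rw [div_mul_eq_div_div, div_eq_mul_inv _ u⁻¹, inv_inv]
  have e3 : bfun (u ^ 2) * (P.q ^ (P.d + 1))⁻¹ * u / bfun (P.q * u ^ 2) =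
    bfun (u ^ 2) * u * (P.q ^ (P.d + 1))⁻¹ / bfun (P.q * u ^ 2) := by ring
  rw [e3]
  generalize bfun (u ^ 2) * u * (P.q ^ (P.d + 1))⁻¹ / bfun (P.q * u ^ 2) = R
  field_simp
  ring

/-- The coefficient of the value at `U(q u)` of the Askey-Wilson operator at `U(u)`. -/
def upCoeff (P : AWParams) (u : ℂ) : ℂ :=
  (P.q - P.q⁻¹) / ((P.q + P.q⁻¹) * bfun (P.q * u ^ 2)) * ((P.q ^ (P.d + 1))⁻¹ *
      ((P.q ^ P.d * P.q⁻¹) ^ 2 * (u ^ 2)⁻¹ + u ^ 2 - P.q ^ P.d * P.q⁻¹ * P.zz) *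
      (P.q ^ 4 * P.b * u ^ 2 * P.q ^ P.d + P.c * (P.q ^ P.d)⁻¹ * (u ^ 2)⁻¹ +
        P.q ^ 2 * P.bcStar))

/-- The coefficient of the value at `U(u / q)` of the Askey-Wilson operator at `U(u)`. -/
def downCoeff (P : AWParams) (u : ℂ) : ℂ :=
  -((P.q - P.q⁻¹) / ((P.q + P.q⁻¹) * bfun (P.q * u ^ 2)) * ((P.q ^ (P.d + 1))⁻¹ *
      ((P.q ^ (P.d + 1)) ^ 2 * u ^ 2 + (u ^ 2)⁻¹ - P.q ^ (P.d + 1) * P.zz) *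
      (P.c * u ^ 2 * (P.q ^ P.d)⁻¹ + P.b * P.q ^ P.d * (u ^ 2)⁻¹ + P.bcStar)))

theorem Generic.rho_inv_eta (h : P.Generic) :
    P.rho⁻¹ * P.eta = (P.bc * P.zz - P.bcStar * P.qq) / (P.q + P.q⁻¹) := by
  have hp := h.add_ne
  have h2 := h.pow_ne two_pos
  have hb := h.b0
  have hc := h.c0
  simp only [rho, eta]
  generalize P.q ^ 2 - (P.q ^ 2)⁻¹ = R at *
  generalize P.q + P.q⁻¹ = R' at *
  field_simp

theorem Generic.rho_inv_etaStar (h : P.Generic) :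
    P.rho⁻¹ * P.etaStar = (P.bcStar * P.zz - P.bc * P.qq) / (P.q + P.q⁻¹) := by
  have hp := h.add_ne
  have h2 := h.pow_ne two_pos
  have hb := h.b0
  have hc := h.c0
  simp only [rho, etaStar, ← h.hbc]
  generalize P.q ^ 2 - (P.q ^ 2)⁻¹ = R at *
  generalize P.q + P.q⁻¹ = R' at *
  field_simp

/-- The zeroth moment in the two-point formula; the next lemma is the first moment. Together they
identify the two coefficients. -/
theorem Generic.upCoeff_add_downCoeff (h : P.Generic) {u : ℂ} (hu : u ≠ 0)
    (hw : bfun (P.q * u ^ 2) ≠ 0) :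
    P.upCoeff u + P.downCoeff u =
      P.theta 1 * P.symRoot u + P.subleading - P.symRoot u * P.theta 0 := by
  have h0 := h.q0
  have hq := h.sq_add_one_ne
  have hw' : P.q ^ 2 * u ^ 4 - 1 ≠ 0 := by
    intro e
    apply hw
    simp only [bfun]
    field_simp
    linear_combination e
  have hbw : bfun (P.q * u ^ 2) = (P.q ^ 2 * u ^ 4 - 1) / (P.q * u ^ 2) := by
    simp only [bfun]; field_simp
  have hpp : P.q + P.q⁻¹ = (P.q ^ 2 + 1) / P.q := by field_simp
  simp only [upCoeff, downCoeff, hbw, hpp, symRoot, theta, subleading]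
  generalize P.zz = z
  generalize P.bcStar = es
  field_simp
  ring

theorem Generic.upCoeff_mul_add_downCoeff_mul (h : P.Generic) {u : ℂ} (hu : u ≠ 0)
    (hw : bfun (P.q * u ^ 2) ≠ 0) :
    P.upCoeff u * P.symRoot (P.q * u) + P.downCoeff u * P.symRoot (u / P.q) =
      (P.q ^ 2 + (P.q ^ 2)⁻¹) * P.symRoot u * (P.theta 1 * P.symRoot u + P.subleading) -
        P.symRoot u ^ 2 * P.theta 0 - (P.q - P.q⁻¹) ^ 2 * (P.theta 0 +
          (P.rho⁻¹ * P.eta * P.symRoot u + P.rho⁻¹ * P.etaStar)) -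
        P.symRoot u * (P.theta 1 * P.symRoot u + P.subleading) := by
  have h0 := h.q0
  have hq := h.sq_add_one_ne
  have hw' : P.q ^ 2 * u ^ 4 - 1 ≠ 0 := by
    intro e
    apply hw
    simp only [bfun]
    field_simp
    linear_combination e
  have hbw : bfun (P.q * u ^ 2) = (P.q ^ 2 * u ^ 4 - 1) / (P.q * u ^ 2) := by
    simp only [bfun]; field_simp
  have hpp : P.q + P.q⁻¹ = (P.q ^ 2 + 1) / P.q := by field_simp
  rw [h.rho_inv_eta, h.rho_inv_etaStar]
  simp only [upCoeff, downCoeff, hbw, hpp, symRoot, theta, subleading, AWParams.bc, qq]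
  generalize P.zz = z
  generalize P.bcStar = es
  field_simp
  ring

/-- The Askey-Wilson operator on polynomials attached to the parameters. -/
def awOperator (P : AWParams) : ℂ[X] →ₗ[ℂ] ℂ[X] :=
  awOp (P.q ^ 2 + (P.q ^ 2)⁻¹) ((P.q - P.q⁻¹) ^ 2) (P.rho⁻¹ * P.eta) (P.rho⁻¹ * P.etaStar)
    (P.theta 0) (P.theta 1) P.subleading

theorem Generic.awOperator_eval (h : P.Generic) {u : ℂ} (hu : u ≠ 0)
    (hw : bfun (P.q * u ^ 2) ≠ 0) (R : ℂ[X]) :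
    (P.awOperator ((X - C (P.symRoot u)) * R)).eval (P.symRoot u) =
      P.upCoeff u * R.eval (P.symRoot (P.q * u)) +
        P.downCoeff u * R.eval (P.symRoot (u / P.q)) := by
  have h0 := h.q0
  have hq := h.sq_add_one_ne
  refine eval_awOp_X_sub_C_mul ?_ ?_ (h.upCoeff_add_downCoeff hu hw)
    (h.upCoeff_mul_add_downCoeff_mul hu hw) R
  · simp only [symRoot]; field_simp; ring
  · simp only [symRoot]; field_simp; ring

theorem Generic.awOperator_eval_eq_zero (h : P.Generic) {M : ℕ} {v : Fin M → ℂ}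
    (hv : P.IsBetheRoots (-1) v) (i : Fin M) :
    (P.awOperator (∏ j, (X - C (P.symRoot (v j))))).eval (P.symRoot (v i)) = 0 := by
  have hu := hv.ne_zero i
  have hb : bfun (v i ^ 2) ≠ 0 := sub_ne_zero.2 (hv.nontrivial i)
  have hw := hv.wellDefined i
  rw [← Finset.mul_prod_erase _ _ (Finset.mem_univ i), h.awOperator_eval hu hw, eval_prod,
    eval_prod]
  simp only [eval_sub, eval_X, eval_C]
  have key := hv.bethe i
  rw [betheE, Finset.prod_congr rfl fun j _ => h.f_eq hu (hv.ne_zero j),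
    Finset.prod_congr (g := fun j => _ / _) rfl fun j _ => h.h_eq hu (hv.ne_zero j),
    Finset.prod_div_distrib, Finset.prod_div_distrib, h.Lam1_eq hu, h.Lam2_eq hu] at key
  have hne : ∏ j ∈ Finset.univ.erase i, (P.symRoot (v i) - P.symRoot (v j)) ≠ 0 :=
    Finset.prod_ne_zero_iff.2 fun j hj =>
      sub_ne_zero.2 (hv.admissible i j (Finset.ne_of_mem_erase hj).symm)
  have hs := h.sub_ne
  have hp := h.add_ne
  simp only [upCoeff, downCoeff]
  generalize ∏ j ∈ Finset.univ.erase i, (P.symRoot (v i) - P.symRoot (v j)) = D at *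
  generalize ∏ j ∈ Finset.univ.erase i, (P.symRoot (v i / P.q) - P.symRoot (v j)) = D1 at *
  generalize ∏ j ∈ Finset.univ.erase i, (P.symRoot (P.q * v i) - P.symRoot (v j)) = D2 at *
  generalize bfun (P.q * v i ^ 2) = w at *
  generalize bfun (v i ^ 2) = w' at *
  generalize P.q - P.q⁻¹ = R at *
  generalize P.q + P.q⁻¹ = R' at *
  -- The two coefficients are `Λ₂` and `-(b(u²)/b(qu²)) Λ₁` times the common factor `(q - q⁻¹) / ((q
  -- + q⁻¹) b(u²) u)`, so the value is a multiple of the Bethe expression.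
  have e : ∀ a b : ℂ, R / (R' * w) * a * D2 + -(R / (R' * w) * b) * D1 =
      R * D / (R' * w' * v i) * (-(w' / w) * (D1 / D) * (v i * b) + D2 / D * (w' * v i / w * a)) := by
    intro a b
    field_simp
    ring
  rw [e]
  refine mul_eq_zero_of_right _ ?_
  rw [← key]
  ring

end scalars

namespace IsAWPair
variable {P : AWParams} {W : Type*} [AddCommGroup W] [Module ℂ W]
  {x y : Module.End ℂ W} {B : Module.Basis (Fin (P.d + 1)) ℂ W}

/-- Bethe roots give eigenvectors of the first operator. -/
theorem aeval_prod_eq (h : P.IsAWPair x y B) (n : ℕ) (hn : n < P.d + 1) {v : Fin n → ℂ}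
    (hv : P.IsBetheRoots (-1) v) :
    aeval (P.sOp x y) (∏ j, (X - C (P.symRoot (v j)))) (B 0) =
      (∏ k : Fin n, B.repr (P.sOp x y (B ⟨k, by omega⟩)) ⟨k + 1, by omega⟩) • B ⟨n, hn⟩ := by
  obtain ⟨-, hc⟩ := h.repr_aeval_prod n hn fun j => P.symRoot (v j)
  rw [← hc]
  have hx : x (aeval (P.sOp x y) (∏ j, (X - C (P.symRoot (v j)))) (B 0)) =
      P.theta n • aeval (P.sOp x y) (∏ j, (X - C (P.symRoot (v j)))) (B 0) := by
    have hrel := h.sOp_rel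
    have h1 := h.x_sOp_zero
    have e0 : x (B 0) = P.theta 0 • B 0 := h.eig 0
    have := apply_aeval_eq_awOp _ _ _ _ _ _ _ x (P.sOp x y) (B 0) e0 h1 hrel
    rw [this]
    have hD := awOp_prod_eq (τ := (P.q - P.q⁻¹) ^ 2) (g := P.rho⁻¹ * P.eta) (g' := P.rho⁻¹ * P.etaStar)
      (k := P.subleading) (t := P.theta) rfl rfl h.theta_rec
      (U := fun j => P.symRoot (v j))
      (fun i j hij => by_contra fun hne => hv.admissible i j hne hij)
      (h.awOperator_eval_eq_zero hv)
    rw [hD, map_smul, LinearMap.smul_apply]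
  refine B.ext_elem fun K => ?_
  have := congrArg (fun w => B.repr w K) hx
  simp only [h.repr_x, map_smul, Finsupp.smul_apply, smul_eq_mul] at this ⊢
  rw [Module.Basis.repr_self]
  by_cases hK : ⟨n, hn⟩ = K
  · subst hK; simp
  -- An eigenvector for `θ_n` has no component along `B K` when `θ_K ≠ θ_n`.
  · rw [Finsupp.single_apply, if_neg hK, mul_zero]
    have hne : P.theta K - P.theta n ≠ 0 :=
      h.theta_ne (by omega) (by omega) fun e => hK (Fin.ext e.symm)
    refine (mul_eq_zero.1 ?_).resolve_left hne
    linear_combination this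

end IsAWPair
-- Passage to the dual space
section dual
variable {P : AWParams} {V : Type*} [AddCommGroup V] [Module ℂ V] [FiniteDimensional ℂ V]

/-- Eigencovectors for distinct eigenvalues, as many as the dimension, form a basis of the dual. -/
theorem exists_basis_of_eigen {n : ℕ} (hdim : Module.finrank ℂ V = n) {a : Module.End ℂ V}
    {t : Fin n → ℂ} (ht : Function.Injective t) {φ : Fin n → Module.Dual ℂ V}
    (hφ0 : ∀ M, φ M ≠ 0) (hφ : ∀ M, φ M ∘ₗ a = t M • φ M) :
    ∃ B : Module.Basis (Fin n) ℂ (Module.Dual ℂ V), ⇑B = φ := by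
  have hli : LinearIndependent ℂ φ :=
    Module.End.eigenvectors_linearIndependent' (a.dualMap : Module.End ℂ (Module.Dual ℂ V)) t ht φ
      fun M => ⟨Module.End.mem_eigenspace_iff.2 (hφ M), hφ0 M⟩
  have hc : Fintype.card (Fin n) = Module.finrank ℂ (Module.Dual ℂ V) := by
    rw [Fintype.card_fin, Subspace.dual_finrank_eq, hdim]
  rcases n with _ | n
  · exact ⟨Module.Basis.mk hli (by
      have : Subsingleton (Module.Dual ℂ V) := Module.finrank_zero_iff.1 hc.symm
      exact fun z _ => by rw [Subsingleton.elim z 0]; exact zero_mem _), by simp⟩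
  · exact ⟨basisOfLinearIndependentOfCardEqFinrank hli hc, by simp⟩

/-- Transposition reverses products, and both relations are invariant under reversal. Stable
subspaces of the dual correspond to stable subspaces of `V` through annihilators, and the
eigencovectors `φs` give the trace. -/
theorem IsAWPair.of_dual (hP : P.Generic)
    (hθs : Function.Injective fun N : Fin (P.d + 1) => P.thetaStar N)
    (hdim : Module.finrank ℂ V = P.d + 1) {a a' : Module.End ℂ V}
    (r1 : a * a * a' - (P.q ^ 2 + (P.q ^ 2)⁻¹) • (a * a' * a) + a' * a * a =
      P.rho • a' + P.omega • a + P.eta • 1)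
    (r2 : a' * a' * a - (P.q ^ 2 + (P.q ^ 2)⁻¹) • (a' * a * a') + a * a' * a' =
      P.rho • a + P.omega • a' + P.etaStar • 1)
    (hirr : ∀ U : Submodule ℂ V, (∀ w ∈ U, a w ∈ U) → (∀ w ∈ U, a' w ∈ U) → U = ⊥ ∨ U = ⊤)
    {φs : Fin (P.d + 1) → Module.Dual ℂ V} (hφs0 : ∀ N, φs N ≠ 0)
    (hφs : ∀ N, φs N ∘ₗ a' = P.thetaStar N • φs N)
    (B : Module.Basis (Fin (P.d + 1)) ℂ (Module.Dual ℂ V))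
    (hB : ∀ M, B M ∘ₗ a = P.theta M • B M) :
    P.IsAWPair (a.dualMap : Module.End ℂ (Module.Dual ℂ V)) a'.dualMap B where
  toGeneric := hP
  rel1 := by
    ext f v
    have := congrArg (fun g : Module.End ℂ V => f (g v)) r1
    simp only [Module.End.mul_apply, LinearMap.add_apply, LinearMap.sub_apply,
      LinearMap.smul_apply, Module.End.one_apply, map_add, map_sub, map_smul,
      LinearMap.dualMap_apply, smul_eq_mul] at this ⊢
    linear_combination this
  rel2 := by
    ext f v
    have := congrArg (fun g : Module.End ℂ V => f (g v)) r2
    simp only [Module.End.mul_apply, LinearMap.add_apply, LinearMap.sub_apply,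
      LinearMap.smul_apply, Module.End.one_apply, map_add, map_sub, map_smul,
      LinearMap.dualMap_apply, smul_eq_mul] at this ⊢
    linear_combination this
  eig := hB
  irr := by
    intro U h1 h2
    have e := Subspace.dualCoannihilator_dualAnnihilator_eq (W := U)
    have := hirr U.dualCoannihilator
      (fun w hw => (Submodule.mem_dualCoannihilator _).2 fun f hf =>
        (Submodule.mem_dualCoannihilator _).1 hw _ (h1 f hf))
      (fun w hw => (Submodule.mem_dualCoannihilator _).2 fun f hf =>
        (Submodule.mem_dualCoannihilator _).1 hw _ (h2 f hf))
    rcases this with h | h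
    · right; rw [← e, h, Submodule.dualAnnihilator_bot]
    · left; rw [← e, h, Submodule.dualAnnihilator_top]
  tr := by
    obtain ⟨C, hC⟩ := exists_basis_of_eigen hdim hθs hφs0 hφs
    rw [LinearMap.trace_eq_matrix_trace ℂ C, Matrix.trace, ← Fin.sum_univ_eq_sum_range]
    refine Finset.sum_congr rfl fun N _ => ?_
    rw [Matrix.diag_apply, LinearMap.toMatrix_apply]
    have : (a'.dualMap : Module.End ℂ (Module.Dual ℂ V)) (C N) = P.thetaStar N • C N := by
      rw [hC]; exact hφs N
    rw [this]
    simp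

/-- The Bethe vectors are eigencovectors, with the product of the superdiagonal entries as
normalization. -/
theorem bethe_eigencovector (hP : P.Generic)
    (hθs : Function.Injective fun N : Fin (P.d + 1) => P.thetaStar N)
    (hdim : Module.finrank ℂ V = P.d + 1) {a a' : Module.End ℂ V}
    (r1 : a * a * a' - (P.q ^ 2 + (P.q ^ 2)⁻¹) • (a * a' * a) + a' * a * a =
      P.rho • a' + P.omega • a + P.eta • 1)
    (r2 : a' * a' * a - (P.q ^ 2 + (P.q ^ 2)⁻¹) • (a' * a * a') + a * a' * a' =
      P.rho • a + P.omega • a' + P.etaStar • 1)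
    (hirr : ∀ U : Submodule ℂ V, (∀ w ∈ U, a w ∈ U) → (∀ w ∈ U, a' w ∈ U) → U = ⊥ ∨ U = ⊤)
    {φ φs : Fin (P.d + 1) → Module.Dual ℂ V} (hφ0 : ∀ M, φ M ≠ 0) (hφs0 : ∀ N, φs N ≠ 0)
    (hφ : ∀ M, φ M ∘ₗ a = P.theta M • φ M) (hφs : ∀ N, φs N ∘ₗ a' = P.thetaStar N • φs N)
    {t : Fin (P.d + 1) → Fin (P.d + 1) → ℂ} (ht : ∀ M, φ M ∘ₗ a' = ∑ M', t M M' • φ M') :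
    (∀ M K : Fin (P.d + 1), (K : ℕ) = M + 1 → t M K ≠ 0) ∧
    ∀ (n : ℕ) (hn : n < P.d + 1) (v : Fin n → ℂ), P.IsBetheRoots (-1) v →
      aeval (P.sOp a.dualMap a'.dualMap) (∏ j, (X - C (P.symRoot (v j)))) (φ 0) =
        (∏ k : Fin n, (-(P.q - P.q⁻¹) * P.rho⁻¹ *
          (P.b * P.q ^ (2 * (k : ℕ) + 1) * (P.q ^ 2 - (P.q ^ 2)⁻¹)) *
            t ⟨k, by omega⟩ ⟨k + 1, by omega⟩)) • φ ⟨n, hn⟩ := by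
  obtain ⟨B, rfl⟩ := exists_basis_of_eigen hdim hP.θinj hφ0 hφ
  have h := IsAWPair.of_dual hP hθs hdim r1 r2 hirr hφs0 hφs B hφ
  have e : ∀ M K, B.repr (a'.dualMap (B M)) K = t M K := by
    intro M K
    have : a'.dualMap (B M) = ∑ M', t M M' • B M' := ht M
    rw [this, B.repr_sum_self]
  refine ⟨fun M K hMK => ?_, fun n hn v hv => ?_⟩
  · rw [← e]; exact h.entry_succ_ne hMK
  · rw [h.aeval_prod_eq n hn hv]
    congr 1
    refine Finset.prod_congr rfl fun k _ => ?_
    rw [← e]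
    exact h.repr_sOp_succ rfl

end dual

/-! ### The symmetry exchanging the two generators -/

/-- The parameters after exchanging the two generators and inverting `q`. -/
def swap (P : AWParams) : AWParams where
  q := P.q⁻¹
  b := P.cs
  c := P.bs
  bs := P.c
  cs := P.b
  ζ := P.ζ
  χ := P.χ
  d := P.d

section swap
variable (P : AWParams)

theorem theta_swap (n : ℕ) : P.swap.theta n = P.thetaStar n := by
  simp only [theta, thetaStar, swap, inv_pow, inv_inv]; ring

theorem thetaStar_swap (n : ℕ) : P.swap.thetaStar n = P.theta n := by
  simp only [theta, thetaStar, swap, inv_pow, inv_inv]; ring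

variable {P}

theorem rho_swap (hbc : P.b * P.c = P.bs * P.cs) : P.swap.rho = P.rho := by
  simp only [rho, hbc, swap, inv_pow, inv_inv]; ring

theorem omega_swap (hbc : P.b * P.c = P.bs * P.cs) : P.swap.omega = P.omega := by
  simp only [omega, hbc, swap, zz, qq, AWParams.bc, bcStar, inv_pow, inv_inv]; ring

theorem eta_swap : P.swap.eta = P.etaStar := by
  simp only [eta, etaStar, swap, zz, qq, AWParams.bc, bcStar, inv_pow, inv_inv]
  rw [add_comm P.q⁻¹]; ring

theorem etaStar_swap : P.swap.etaStar = P.eta := by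
  simp only [eta, etaStar, swap, zz, qq, AWParams.bc, bcStar, inv_pow, inv_inv]
  rw [add_comm P.q⁻¹]; ring

theorem symRoot_swap (u : ℂ) : P.swap.symRoot u⁻¹ = P.symRoot u := by
  simp only [symRoot, swap, inv_pow, inv_inv]
  rw [add_comm P.q⁻¹, add_comm]

theorem f_swap (u v : ℂ) : P.swap.f u⁻¹ v⁻¹ = P.f u v := by
  simp only [f, swap]
  rw [show P.q⁻¹ * v⁻¹ / u⁻¹ = (P.q * v / u)⁻¹ by simp only [div_eq_mul_inv, mul_inv],
    show v⁻¹ / u⁻¹ = (v / u)⁻¹ by simp only [div_eq_mul_inv, mul_inv],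
    ← mul_inv, ← mul_inv, ← mul_inv]
  simp only [bfun_inv, neg_mul_neg]

theorem h_swap (u v : ℂ) : P.swap.h u⁻¹ v⁻¹ = P.h u v := by
  simp only [h, swap]
  rw [show P.q⁻¹ * u⁻¹ / v⁻¹ = (P.q * u / v)⁻¹ by simp only [div_eq_mul_inv, mul_inv],
    show u⁻¹ / v⁻¹ = (u / v)⁻¹ by simp only [div_eq_mul_inv, mul_inv], inv_pow,
    ← mul_inv, ← mul_inv, ← mul_inv, ← mul_inv]
  simp only [bfun_inv, neg_mul_neg]

theorem Generic.Lam1_swap (h : P.Generic) {u : ℂ} (hu : u ≠ 0) :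
    P.swap.Lam1 (-1) u⁻¹ = P.Lam1 1 u := by
  have h0 := h.q0
  have hb := h.b0
  have hζ := h.ζ0
  have e1 : (1 - (-1 : ℤ)) / 2 = 1 := by norm_num
  have e2 : (1 + (-1 : ℤ)) / 2 = 0 := by norm_num
  have e3 : (1 - (1 : ℤ)) / 2 = 0 := by norm_num
  have e4 : (1 + (1 : ℤ)) / 2 = 1 := by norm_num
  simp only [Lam1, swap, e1, e2, e3, e4, zpow_one, zpow_zero, zpow_neg, inv_pow, inv_inv]
  field_simp
  ring

theorem Generic.Lam2_swap (h : P.Generic) {u : ℂ} (hu : u ≠ 0) :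
    P.swap.Lam2 (-1) u⁻¹ = P.Lam2 1 u := by
  have h0 := h.q0
  have hb := h.b0
  have hζ := h.ζ0
  have e1 : (1 - (-1 : ℤ)) / 2 = 1 := by norm_num
  have e2 : (1 + (-1 : ℤ)) / 2 = 0 := by norm_num
  have e3 : (1 - (1 : ℤ)) / 2 = 0 := by norm_num
  have e4 : (1 + (1 : ℤ)) / 2 = 1 := by norm_num
  simp only [Lam2, swap, e1, e2, e3, e4, zpow_one, zpow_zero, zpow_neg, inv_pow, inv_inv,
    ← mul_inv, bfun_inv, zpow_sub₀ h0, zpow_sub₀ (inv_ne_zero h0), zpow_natCast]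
  generalize bfun (u ^ 2) = A
  generalize bfun (P.q * u ^ 2) = A'
  have e5 : -A * P.q ^ (P.d + 1) / (u * -A') = A / A' * (P.q ^ (P.d + 1) / u) := by
    rw [mul_neg, neg_mul, neg_div_neg_eq]; ring
  have e6 : A * (P.q ^ (P.d + 1))⁻¹ / (u * A') = A / A' * ((P.q ^ (P.d + 1))⁻¹ / u) := by ring
  rw [e5, e6]
  generalize A / A' = R
  field_simp
  ring

theorem Generic.isBetheRoots_swap (h : P.Generic) {M : ℕ} {y : Fin M → ℂ}
    (hy : P.IsBetheRoots 1 y) : P.swap.IsBetheRoots (-1) fun i => (y i)⁻¹ where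
  ne_zero i := inv_ne_zero (hy.ne_zero i)
  nontrivial i := by
    have := hy.nontrivial i
    rw [inv_pow, inv_inv]
    exact this.symm
  wellDefined i := by
    have : P.swap.q * (y i)⁻¹ ^ 2 = (P.q * y i ^ 2)⁻¹ := by
      simp only [swap, inv_pow, mul_inv]
    rw [this, bfun_inv]
    exact neg_ne_zero.2 (hy.wellDefined i)
  admissible i j hij := by
    rw [symRoot_swap, symRoot_swap]
    exact hy.admissible i j hij
  bethe i := by
    rw [← hy.bethe i]
    have : P.swap.q * (y i)⁻¹ ^ 2 = (P.q * y i ^ 2)⁻¹ := by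
      simp only [swap, inv_pow, mul_inv]
    rw [betheE, this, inv_pow, bfun_inv, bfun_inv, neg_div_neg_eq]
    simp only [betheE, f_swap, h_swap, h.Lam1_swap (hy.ne_zero i), h.Lam2_swap (hy.ne_zero i)]

theorem Generic.swap (h : P.Generic)
    (hθs : Function.Injective fun N : Fin (P.d + 1) => P.thetaStar N) : P.swap.Generic where
  q0 := inv_ne_zero h.q0
  hq k hk := by
    change P.q⁻¹ ^ k ≠ 1
    rw [inv_pow]
    exact fun e => h.hq k hk (inv_eq_one.1 e)
  b0 := h.cs0
  c0 := h.bs0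
  bs0 := h.c0
  cs0 := h.b0
  hbc := by
    change P.cs * P.bs = P.c * P.b
    rw [mul_comm, ← h.hbc, mul_comm]
  ζ0 := h.ζ0
  θinj := by
    simp only [theta_swap]
    exact hθs

/-- Exchanging the operators and inverting `q` changes the sign of both the `q`-commutator and `q -
q⁻¹`. Hence both families of Bethe states use the same `S`. -/
theorem Generic.sOp_swap (h : P.Generic) {W : Type*} [AddCommGroup W] [Module ℂ W]
    (x y : Module.End ℂ W) : P.swap.sOp y x = P.sOp x y := by
  have hs := h.sub_ne
  simp only [sOp, rho_swap h.hbc, omega_swap h.hbc]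
  simp only [AWParams.swap, inv_inv]
  have e : P.q⁻¹ - P.q = -(P.q - P.q⁻¹) := by ring
  rw [e]
  generalize P.q - P.q⁻¹ = s at *
  match_scalars <;> field_simp

end swap

/-! ### Dual Bethe states as polynomials in `sOp` -/

section bethe
variable {P : AWParams} {V : Type*} [AddCommGroup V] [Module ℂ V]

theorem dualMap_aeval (s : Module.End ℂ V) (Q : ℂ[X]) (f : Module.Dual ℂ V) :
    f ∘ₗ aeval s Q = aeval (s.dualMap : Module.End ℂ (Module.Dual ℂ V)) Q f := by
  have hpow : ∀ (n : ℕ) (f : Module.Dual ℂ V),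
      f ∘ₗ (s ^ n) = ((s.dualMap : Module.End ℂ (Module.Dual ℂ V)) ^ n) f := by
    intro n
    induction n with
    | zero => intro f; rfl
    | succ n ih =>
      intro f
      rw [pow_succ', pow_succ, Module.End.mul_apply, ← ih]
      rfl
  induction Q using Polynomial.induction_on' with
  | add p r hp hr => simp only [map_add, LinearMap.comp_add, hp, hr, LinearMap.add_apply]
  | monomial n a =>
    rw [← C_mul_X_pow_eq_monomial, ← smul_eq_C_mul]
    simp only [map_smul, map_pow, aeval_X, LinearMap.comp_smul, LinearMap.smul_apply, hpow]

/-- The dual Bethe states as polynomials in `sOp` applied to the reference covector. -/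
theorem Generic.dualBethe_eq (h : P.Generic) (π : P.AW →ₐ[ℂ] Module.End ℂ V) (β : ℂ) (ε : ℤ)
    (Ω : Module.Dual ℂ V) {N : ℕ} (v : Fin N → ℂ) (m₀ : ℤ) :
    P.dualBethe π β ε Ω v m₀ =
      (∏ i : Fin N, -((ε : ℂ) * P.q ^ (-ε) * v i ^ (-ε) *
        (P.gam 0 β ε 1 (m₀ + 2 * ((i : ℕ) + 1 : ℤ) - 1))⁻¹ * (P.χ * bfun (v i ^ 2)) /
          (P.q - P.q⁻¹))) •
      aeval (P.sOp (π P.genA).dualMap (π P.genAStar).dualMap)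
        (∏ j, (X - C (P.symRoot (v j)))) Ω := by
  have hs := h.sub_ne
  have hp := h.add_ne
  have hr := h.rho_ne
  set s : Module.End ℂ V := (-(P.q - P.q⁻¹) * P.rho⁻¹) •
    (P.q • (π P.genAStar * π P.genA) - P.q⁻¹ • (π P.genA * π P.genAStar) +
      (P.omega / (P.q - P.q⁻¹)) • 1) with hsdef
  have hsd : P.sOp (π P.genA).dualMap (π P.genAStar).dualMap = s.dualMap := by
    ext f v
    simp only [hsdef, sOp, Module.End.mul_apply, LinearMap.add_apply, LinearMap.sub_apply,
      LinearMap.smul_apply, Module.End.one_apply, map_add, map_sub, map_smul,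
      LinearMap.dualMap_apply, smul_eq_mul]
  -- For `α = 0` only `K₁₂` survives, and `m` enters only through a scalar. The normalization of
  -- `sOp` is the one that makes `K₁₂` proportional to `S - U(u)`.
  have hdyn : ∀ (u : ℂ) (m : ℤ), π (P.dynC 0 β ε u m) =
      aeval s (C (-((ε : ℂ) * P.q ^ (-ε) * u ^ (-ε) * (P.gam 0 β ε 1 (m - 1))⁻¹ *
        (P.χ * bfun (u ^ 2)) / (P.q - P.q⁻¹))) * (X - C (P.symRoot u))) := by
    intro u m
    have hκ : (P.q * u ^ 2 + (P.q * u ^ 2)⁻¹) / (P.q ^ 2 - (P.q ^ 2)⁻¹) =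
        P.symRoot u / (P.q - P.q⁻¹) := by
      rw [symRoot, div_div, mul_inv]
      congr 1
      have := h.q0
      field_simp
      ring
    rw [← smul_eq_C_mul, map_smul, map_sub, aeval_X, aeval_C, Algebra.algebraMap_eq_smul_one]
    simp only [dynC, K, hκ, zero_mul, zero_smul, zero_add, add_zero, Matrix.of_apply,
      Matrix.cons_val_zero, Matrix.cons_val_one, qcomm, map_smul, map_neg, map_add, map_sub,
      map_mul, map_one, hsdef]
    generalize P.gam 0 β ε 1 (m - 1) = γ
    generalize P.symRoot u = U
    generalize P.q - P.q⁻¹ = R at *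
    match_scalars <;> field_simp <;> ring
  rw [hsd, ← dualMap_aeval, dualBethe, stringC, map_list_prod, List.map_ofFn]
  have : (⇑π ∘ fun i : Fin N => P.dynC 0 β ε (v i) (m₀ + 2 * ((i : ℕ) + 1 : ℤ))) =
      aeval s ∘ fun i : Fin N => C (-((ε : ℂ) * P.q ^ (-ε) * v i ^ (-ε) *
        (P.gam 0 β ε 1 (m₀ + 2 * ((i : ℕ) + 1 : ℤ) - 1))⁻¹ * (P.χ * bfun (v i ^ 2)) /
          (P.q - P.q⁻¹))) * (X - C (P.symRoot (v i))) := funext fun i => hdyn _ _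
  rw [this, ← List.map_ofFn, ← map_list_prod, List.prod_ofFn, Finset.prod_mul_distrib,
    ← map_prod, ← smul_eq_C_mul, map_smul, LinearMap.comp_smul]

end bethe

/-! ### Relations in the representation, and normalization constants -/

theorem genA_rel (P : AWParams) (hq : P.q ≠ 0) {R : Type*} [Ring R] [Algebra ℂ R]
    (π : P.AW →ₐ[ℂ] R) :
    π P.genA * π P.genA * π P.genAStar -
      (P.q ^ 2 + (P.q ^ 2)⁻¹) • (π P.genA * π P.genAStar * π P.genA) +
      π P.genAStar * π P.genA * π P.genA =
    P.rho • π P.genAStar + P.omega • π P.genA + P.eta • 1 := by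
  have := congrArg π (RingQuot.mkAlgHom_rel ℂ (AWRel.rel1 (P := P)))
  simp only [qcomm, map_sub, map_add, map_smul, map_mul, map_one, mul_sub, sub_mul,
    mul_smul_comm, smul_mul_assoc, ← mul_assoc] at this
  change _ = P.rho • π P.genAStar + P.omega • π P.genA + P.eta • 1 at this
  rw [← this]
  simp only [genA, genAStar]
  match_scalars <;> field_simp <;> ring

theorem genAStar_rel (P : AWParams) (hq : P.q ≠ 0) {R : Type*} [Ring R] [Algebra ℂ R]
    (π : P.AW →ₐ[ℂ] R) :
    π P.genAStar * π P.genAStar * π P.genA -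
      (P.q ^ 2 + (P.q ^ 2)⁻¹) • (π P.genAStar * π P.genA * π P.genAStar) +
      π P.genA * π P.genAStar * π P.genAStar =
    P.rho • π P.genA + P.omega • π P.genAStar + P.etaStar • 1 := by
  have := congrArg π (RingQuot.mkAlgHom_rel ℂ (AWRel.rel2 (P := P)))
  simp only [qcomm, map_sub, map_add, map_smul, map_mul, map_one, mul_sub, sub_mul,
    mul_smul_comm, smul_mul_assoc, ← mul_assoc] at this
  change _ = P.rho • π P.genA + P.omega • π P.genAStar + P.etaStar • 1 at this
  rw [← this]
  simp only [genA, genAStar]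
  match_scalars <;> field_simp <;> ring

/-- A subspace stable under the two generators is stable under the Askey-Wilson algebra. -/
theorem stable_of_generators (P : AWParams) {V : Type*} [AddCommGroup V] [Module ℂ V]
    (π : P.AW →ₐ[ℂ] Module.End ℂ V) {U : Submodule ℂ V} (h1 : ∀ w ∈ U, π P.genA w ∈ U)
    (h2 : ∀ w ∈ U, π P.genAStar w ∈ U) (x : P.AW) : ∀ w ∈ U, π x w ∈ U := by
  obtain ⟨z, rfl⟩ := RingQuot.mkAlgHom_surjective ℂ (AWRel P) x
  induction z using FreeAlgebra.induction with
  | grade0 r =>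
    intro w hw
    rw [AlgHom.commutes, AlgHom.commutes, Module.algebraMap_end_apply]
    exact U.smul_mem r hw
  | grade1 i =>
    fin_cases i
    · exact h1
    · exact h2
  | mul a b ha hb =>
    intro w hw
    rw [map_mul, map_mul, Module.End.mul_apply]
    exact ha _ (hb w hw)
  | add a b ha hb =>
    intro w hw
    rw [map_add, map_add, LinearMap.add_apply]
    exact U.add_mem (ha w hw) (hb w hw)

/-- The normalization of one step of the state with sign `-`. -/
theorem Generic.norm_minus {P : AWParams} (h : P.Generic) (hχ : P.χ ≠ 0) {β : ℂ} {m₀ : ℤ}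
    (hβ : (P.q ^ 2 - (P.q ^ 2)⁻¹) * P.χ⁻¹ * β * P.c * P.q ^ (m₀ - 2) = -1) {v t : ℂ}
    (hv : v ≠ 0) (hb : bfun (v ^ 2) ≠ 0) (ht : t ≠ 0) (k : ℕ) :
    (P.q⁻¹ * v * bfun (v ^ 2) * t)⁻¹ * (-(((-1 : ℤ) : ℂ) * P.q ^ (-(-1 : ℤ)) * v ^ (-(-1 : ℤ)) *
        (P.gam 0 β (-1) 1 (m₀ + 2 * ((k : ℤ) + 1) - 1))⁻¹ * (P.χ * bfun (v ^ 2)) /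
          (P.q - P.q⁻¹)) * (-(P.q - P.q⁻¹) * P.rho⁻¹ *
          (P.b * P.q ^ (2 * k + 1) * (P.q ^ 2 - (P.q ^ 2)⁻¹)) * t)) = 1 := by
  have h0 := h.q0
  have hs := h.sub_ne
  have hb0 := h.b0
  have hc0 := h.c0
  have h2 := h.pow_ne two_pos
  have hβ0 : β ≠ 0 := by rintro rfl; simp at hβ
  have e1 : (1 - (-1 : ℤ)) / 2 = 1 := by norm_num
  have e2 : (1 + (-1 : ℤ)) / 2 = 0 := by norm_num
  -- The exponent is split so that `q^(2k+1)` cancels the same power in the superdiagonal entry of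
  -- `sOp`, and `q^(m₀-2)` is the power fixed by the condition on `β`.
  have hg : P.gam 0 β (-1) 1 (m₀ + 2 * ((k : ℤ) + 1) - 1) =
      -(β * P.q ^ (m₀ - 2) * P.q ^ 2 * P.q ^ (2 * k + 1)) := by
    have : m₀ + 2 * ((k : ℤ) + 1) - 1 = (m₀ - 2) + (2 : ℕ) + (2 * k + 1 : ℕ) := by
      push_cast; ring
    rw [gam, e1, e2, this, zpow_add₀ h0, zpow_add₀ h0, zpow_natCast, zpow_natCast]
    simp; ring
  have hm : P.q ^ (m₀ - 2) ≠ 0 := zpow_ne_zero _ h0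
  have hk : P.q ^ (2 * k + 1) ≠ 0 := pow_ne_zero _ h0
  rw [hg, rho]
  simp only [neg_neg, zpow_one, Int.cast_neg, Int.cast_one]
  generalize P.q ^ (2 * k + 1) = K at *
  generalize P.q ^ (m₀ - 2) = m at *
  generalize P.q ^ 2 - (P.q ^ 2)⁻¹ = R at *
  generalize P.q - P.q⁻¹ = r at *
  generalize bfun (v ^ 2) = w at *
  have hβ' : R * β * P.c * m = -P.χ := by
    field_simp at hβ
    linear_combination hβ
  field_simp
  linear_combination -hβ'

/-- The normalization of one step of the state with sign `+`. -/
theorem Generic.norm_plus {P : AWParams} (h : P.Generic) (hχ : P.χ ≠ 0) {β : ℂ} {m₀ : ℤ}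
    (hβ : (P.q ^ 2 - (P.q ^ 2)⁻¹) * P.χ⁻¹ * β * P.bs * P.q ^ (-m₀ + 2) = 1) {v t : ℂ}
    (hv : v ≠ 0) (hb : bfun (v ^ 2) ≠ 0) (ht : t ≠ 0) (k : ℕ) :
    (-(P.q * v⁻¹ * bfun (v ^ 2) * t))⁻¹ * (-(((1 : ℤ) : ℂ) * P.q ^ (-(1 : ℤ)) * v ^ (-(1 : ℤ)) *
        (P.gam 0 β 1 1 (m₀ + 2 * ((k : ℤ) + 1) - 1))⁻¹ * (P.χ * bfun (v ^ 2)) /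
          (P.q - P.q⁻¹)) * (-(P.swap.q - P.swap.q⁻¹) * P.swap.rho⁻¹ *
          (P.swap.b * P.swap.q ^ (2 * k + 1) * (P.swap.q ^ 2 - (P.swap.q ^ 2)⁻¹)) * t)) = 1 := by
  have h0 := h.q0
  have hs := h.sub_ne
  have hb0 := h.bs0
  have hc0 := h.cs0
  have h2 := h.pow_ne two_pos
  have hβ0 : β ≠ 0 := by rintro rfl; simp at hβ
  have e1 : (1 - (1 : ℤ)) / 2 = 0 := by norm_num
  have e2 : (1 + (1 : ℤ)) / 2 = 1 := by norm_num
  -- The same splitting, with `q^(-(2k+1))` matching the entry computed with the inverted `q`.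
  have hg : P.gam 0 β 1 1 (m₀ + 2 * ((k : ℤ) + 1) - 1) =
      β * P.q ^ (-m₀ + 2) * (P.q ^ 2)⁻¹ * (P.q ^ (2 * k + 1))⁻¹ := by
    have : -(m₀ + 2 * ((k : ℤ) + 1) - 1) = (-m₀ + 2) + -(2 : ℕ) + -(2 * k + 1 : ℕ) := by
      push_cast; ring
    rw [gam, e1, e2, this, zpow_add₀ h0, zpow_add₀ h0, zpow_neg, zpow_neg, zpow_natCast,
      zpow_natCast]
    simp; ring
  have hm : P.q ^ (-m₀ + 2) ≠ 0 := zpow_ne_zero _ h0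
  have hk : P.q ^ (2 * k + 1) ≠ 0 := pow_ne_zero _ h0
  have es : P.q⁻¹ - P.q = -(P.q - P.q⁻¹) := by ring
  have es2 : (P.q ^ 2)⁻¹ - P.q ^ 2 = -(P.q ^ 2 - (P.q ^ 2)⁻¹) := by ring
  rw [hg, rho_swap h.hbc, rho, h.hbc]
  simp only [AWParams.swap, inv_pow, inv_inv, es, es2, zpow_neg, zpow_one, Int.cast_one]
  generalize P.q ^ (2 * k + 1) = K at *
  generalize P.q ^ (-m₀ + 2) = m at *
  generalize P.q ^ 2 - (P.q ^ 2)⁻¹ = R at *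
  generalize P.q - P.q⁻¹ = r at *
  generalize bfun (v ^ 2) = w at *
  have hβ' : R * β * P.bs * m = P.χ := by
    field_simp at hβ
    linear_combination hβ
  field_simp
  linear_combination -hβ'

end AWParams

end

theorem mainTheorem4 (P : AWParams)
    (hq0 : P.q ≠ 0) (hq : ∀ k : ℕ, 0 < k → P.q ^ k ≠ 1)
    (hb : P.b ≠ 0) (hc : P.c ≠ 0) (hbs : P.bs ≠ 0) (hcs : P.cs ≠ 0)
    (hbc : P.b * P.c = P.bs * P.cs) (hζ : P.ζ ≠ 0) (hχ : P.χ ≠ 0)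
    {V : Type*} [AddCommGroup V] [Module ℂ V] [FiniteDimensional ℂ V]
    (hdim : Module.finrank ℂ V = P.d + 1)
    (π : P.AW →ₐ[ℂ] Module.End ℂ V)
    -- irreducibility
    (hirr : ∀ W : Submodule ℂ V, (∀ x : P.AW, ∀ w ∈ W, π x w ∈ W) → W = ⊥ ∨ W = ⊤)
    -- the spectra are multiplicity-free
    (hθ : Function.Injective fun M : Fin (P.d + 1) => P.theta M)
    (hθs : Function.Injective fun N : Fin (P.d + 1) => P.thetaStar N)
    -- the dual eigenbases `⟨θ_M|` and `⟨θ*_N|`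
    (φ φs : Fin (P.d + 1) → Module.Dual ℂ V)
    (hφ0 : ∀ M, φ M ≠ 0) (hφs0 : ∀ N, φs N ≠ 0)
    (hφ : ∀ M, φ M ∘ₗ π P.genA = P.theta M • φ M)
    (hφs : ∀ N, φs N ∘ₗ π P.genAStar = P.thetaStar N • φs N)
    -- `Ã*`, `Ã`: the coefficients of the right action of `A*`, `A` on these dual eigenbases
    (tAs tA : Fin (P.d + 1) → Fin (P.d + 1) → ℂ)
    (htAs : ∀ M, φ M ∘ₗ π P.genAStar = ∑ M', tAs M M' • φ M')
    (htA : ∀ N, φs N ∘ₗ π P.genA = ∑ N', tA N N' • φs N')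
    (m₀ : ℤ) :
    (∀ β : ℂ, (P.q ^ 2 - (P.q ^ 2)⁻¹) * P.χ⁻¹ * β * P.c * P.q ^ (m₀ - 2) = -1 →
      ∀ (M : Fin (P.d + 1)) (v : Fin M → ℂ), P.IsBetheRoots (-1) v →
        φ M =
          (∏ k : Fin M, (P.q⁻¹ * v k * bfun (v k ^ 2) *
            tAs ⟨k, by omega⟩ ⟨k + 1, by omega⟩)⁻¹) • P.dualBethe π β (-1) (φ 0) v m₀) ∧
    (∀ β : ℂ, (P.q ^ 2 - (P.q ^ 2)⁻¹) * P.χ⁻¹ * β * P.bs * P.q ^ (-m₀ + 2) = 1 →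
      ∀ (N : Fin (P.d + 1)) (y : Fin N → ℂ), P.IsBetheRoots 1 y →
        φs N =
          (∏ k : Fin N, (-(P.q * (y k)⁻¹ * bfun (y k ^ 2) *
            tA ⟨k, by omega⟩ ⟨k + 1, by omega⟩))⁻¹) • P.dualBethe π β 1 (φs 0) y m₀) := by
  have hP : P.Generic := ⟨hq0, hq, hb, hc, hbs, hcs, hbc, hζ, hθ⟩
  have r1 := P.genA_rel hq0 π
  have r2 := P.genAStar_rel hq0 π
  refine ⟨fun β hβ M v hv => ?_, fun β hβ N y hy => ?_⟩
  · obtain ⟨hne, key⟩ := AWParams.bethe_eigencovector hP hθs hdim r1 r2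
      (fun U h1 h2 => hirr U (P.stable_of_generators π h1 h2)) hφ0 hφs0 hφ hφs htAs
    rw [hP.dualBethe_eq, key M M.2 v hv, smul_smul, smul_smul, ← Finset.prod_mul_distrib,
      ← Finset.prod_mul_distrib, Finset.prod_eq_one, one_smul]
    intro k _
    rw [mul_assoc]
    exact hP.norm_minus hχ hβ (hv.ne_zero k) (sub_ne_zero.2 (hv.nontrivial k)) (hne _ _ rfl) k
  · obtain ⟨hne, key⟩ := AWParams.bethe_eigencovector (P := P.swap) (hP.swap hθs)
      (by simp only [AWParams.thetaStar_swap]; exact hθ) hdim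
      (a := π P.genAStar) (a' := π P.genA)
      (by
        rw [AWParams.rho_swap hbc, AWParams.omega_swap hbc, AWParams.eta_swap]
        simpa [AWParams.swap, add_comm] using r2)
      (by
        rw [AWParams.rho_swap hbc, AWParams.omega_swap hbc, AWParams.etaStar_swap]
        simpa [AWParams.swap, add_comm] using r1)
      (fun U h1 h2 => hirr U (P.stable_of_generators π h2 h1)) hφs0 hφ0
      (fun N => by rw [AWParams.theta_swap]; exact hφs N)
      (fun M => by rw [AWParams.thetaStar_swap]; exact hφ M) htA
    -- The sign `-` statement for the swapped parameters at the inverse roots: `symRoot` and `sOp`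
    -- are unchanged, so the polynomial in `sOp` is the original one.
    have hk : Polynomial.aeval (P.sOp (π P.genA).dualMap (π P.genAStar).dualMap)
        (∏ j, (Polynomial.X - Polynomial.C (P.symRoot (y j)))) (φs 0) =
        (∏ k : Fin N, (-(P.swap.q - P.swap.q⁻¹) * P.swap.rho⁻¹ *
          (P.swap.b * P.swap.q ^ (2 * (k : ℕ) + 1) * (P.swap.q ^ 2 - (P.swap.q ^ 2)⁻¹)) *
            tA ⟨k, by omega⟩ ⟨k + 1, by omega⟩)) • φs N := by
      have := key N N.2 (fun i => (y i)⁻¹) (hP.isBetheRoots_swap hy)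
      simp only [AWParams.symRoot_swap, hP.sOp_swap] at this
      exact this
    rw [hP.dualBethe_eq, hk, smul_smul, smul_smul, ← Finset.prod_mul_distrib,
      ← Finset.prod_mul_distrib, Finset.prod_eq_one, one_smul]
    intro k _
    rw [mul_assoc]
    exact hP.norm_plus hχ hβ (hy.ne_zero k) (sub_ne_zero.2 (hy.nontrivial k)) (hne _ _ rfl) k
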